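/- Let $\theta\in\mathbb R$ be irrational, $q=e^{2\pi i\theta}$, and let $\tau\in\mathbb C$ with $\operatorname{Im}\tau<0$. Let $\mathcal O(\mathbb C^*)$ be the ring of holomorphic functions on $\mathbb C^*=\mathbb C\setminus\{0\}$, with the automorphism $\alpha(f)(z)=f(qz)$, which generates an action of $\theta\mathbb Z$, and the derivation $\delta=\tau z\frac{d}{dz}$. Let $\mathcal B_q$ be the category of pairs $(M,\sigma)$, where $M$ is a finitely presentable $\mathcal O(\mathbb C^*)$-module and $\sigma$ is a representation of $\theta\mathbb Z$ on $M$ covering $\alpha$, i.e. (writing $\sigma$ for the action of the generator) $\sigma(mf)=\sigma(m)\alpha(f)$; morphisms are the equivariant $\mathcal O(\mathbb C^*)$-linear maps. Let $\mathcal B_q^\tau$ be the category of triples $(M,\sigma,\nabla)$, where $(M,\sigma)$ is an object of $\mathcal B_q$ and $\nabla$ is an equivariant connection on $M$ covering $\delta$, i.e. $\nabla(mf)=\nabla(m)f+m\,\delta(f)$ and $\nabla\sigma=\sigma\nabla$, which is regular singular: $M$ has a module basis $e_1,\dots,e_n$ for which the functions $z^{-1}A_{ij}$, where $\nabla(e_i)=\sum_j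 A_{ij}e_j$, have at most simple poles at $0$. Morphisms in $\mathcal B_q^\tau$ are the morphisms of $\mathcal B_q$ that commute with the connections. Then the category $\mathcal B_q^\tau$, with pointwise addition of morphisms, is abelian. Moreover, for every morphism $f:M\to N$ of $\mathcal B_q^\tau$: 1. $f$ has a kernel in $\mathcal B_q$, and for every kernel $\iota:K\to M$ of $f$ in $\mathcal B_q$ there is a unique equivariant connection on $K$ covering $\delta$ that is compatible with $\iota$; this connection is regular singular, and $K$ with this connection and $\iota$ is a kernel of $f$ in $\mathcal B_q^\tau$. 2. $f$ has a cokernel in $\mathcal B_q$, and for every cokernel $\pi:N\to C$ of $f$ in $\mathcal B_q$ there is a unique equivariant connection on $C$ covering $\delta$ that is compatible with $\pi$; this connection is regular singular, and $C$ with this connection and $\pi$ is a cokernel of $f$ in $\mathcal B_q^\tau$. -/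

import Mathlib

open CategoryTheory CategoryTheory.Limits

universe w

noncomputable section

namespace NCEllipticCurve

/-- Extension by zero to `ℂ` of a function on the punctured plane `ℂˣ = ℂ ∖ {0}`. -/
def extendZero (f : ℂˣ → ℂ) (z : ℂ) : ℂ :=
  if h : z = 0 then 0 else f (Units.mk0 z h)

theorem extendZero_coe (f : ℂˣ → ℂ) (u : ℂˣ) : extendZero f u = f u := by
  simp [extendZero]

theorem extendZero_of_ne (f : ℂˣ → ℂ) {z : ℂ} (h : z ≠ 0) :
    extendZero f z = f (Units.mk0 z h) := by
  simp [extendZero, h]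

/-- The ring `𝒪(ℂ*)` of holomorphic functions on the punctured plane. -/
def OCstar : Subalgebra ℂ (ℂˣ → ℂ) where
  carrier := {f | DifferentiableOn ℂ (extendZero f) {0}ᶜ}
  mul_mem' := by
    intro f g hf hg
    refine (DifferentiableOn.mul hf hg).congr ?_
    intro z hz
    simp [extendZero_of_ne _ (show z ≠ 0 from hz)]
  add_mem' := by
    intro f g hf hg
    refine (DifferentiableOn.add hf hg).congr ?_
    intro z hz
    simp [extendZero_of_ne _ (show z ≠ 0 from hz)]
  algebraMap_mem' := by
    intro c
    refine (differentiableOn_const c).congr ?_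
    intro z hz
    simp [extendZero_of_ne _ (show z ≠ 0 from hz)]

/-- `q = exp (2 π i θ)`, as a point of the punctured plane. -/
def q (θ : ℝ) : ℂˣ :=
  Units.mk0 (Complex.exp (2 * Real.pi * Complex.I * θ)) (Complex.exp_ne_zero _)

/-- The automorphism `(α f)(z) = f (q z)` of `𝒪(ℂ*)`. -/
def alpha (θ : ℝ) : OCstar →ₐ[ℂ] OCstar where
  toFun f := ⟨fun u => f.1 (q θ * u), by
    have h : DifferentiableOn ℂ (fun z => extendZero f.1 ((q θ : ℂ) * z)) {0}ᶜ := by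
      refine DifferentiableOn.comp (t := {0}ᶜ) f.2
        (differentiableOn_id.const_mul _) ?_
      intro z hz
      exact mul_ne_zero (q θ).ne_zero hz
    refine h.congr ?_
    intro z hz
    have hz' : z ≠ 0 := hz
    rw [extendZero_of_ne _ hz', extendZero_of_ne _ (mul_ne_zero (q θ).ne_zero hz')]
    exact congrArg f.1 (Units.ext rfl)⟩
  map_one' := rfl
  map_mul' _ _ := rfl
  map_zero' := rfl
  map_add' _ _ := rfl
  commutes' _ := rfl

/-- The derivation `δ = τ z d/dz` of `𝒪(ℂ*)`. -/
def delta (τ : ℂ) : Derivation ℂ OCstar OCstar :=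
  Derivation.mk'
    { toFun := fun f => ⟨fun u => τ * u * deriv (extendZero f.1) u, by
        have h : DifferentiableOn ℂ (fun z => τ * z * deriv (extendZero f.1) z) {0}ᶜ :=
          (differentiableOn_id.const_mul τ).mul
            (DifferentiableOn.deriv f.2 isOpen_compl_singleton)
        refine h.congr ?_
        intro z hz
        simp [extendZero_of_ne _ (show z ≠ 0 from hz)]⟩
      map_add' := by
        intro f g
        ext u
        have hu : ({0}ᶜ : Set ℂ) ∈ nhds (u : ℂ) := isOpen_compl_singleton.mem_nhds u.ne_zero
        have h : extendZero (f.1 + g.1) = extendZero f.1 + extendZero g.1 := by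
          ext z
          by_cases hz : z = 0 <;> simp [extendZero, hz]
        have hd := deriv_add (f.2.differentiableAt hu) (g.2.differentiableAt hu)
        change τ * u * deriv (extendZero (f.1 + g.1)) u =
          τ * u * deriv (extendZero f.1) u + τ * u * deriv (extendZero g.1) u
        rw [h, hd]
        ring
      map_smul' := by
        intro c f
        ext u
        have hu : ({0}ᶜ : Set ℂ) ∈ nhds (u : ℂ) := isOpen_compl_singleton.mem_nhds u.ne_zero
        have h : extendZero (c • f.1) = c • extendZero f.1 := by
          ext z
          by_cases hz : z = 0 <;> simp [extendZero, hz]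
        have hd := deriv_const_smul c (f.2.differentiableAt hu)
        change τ * u * deriv (extendZero (c • f.1)) u =
          c * (τ * u * deriv (extendZero f.1) u)
        rw [h, hd, smul_eq_mul]
        ring }
    (by
      intro f g
      ext u
      have hu : ({0}ᶜ : Set ℂ) ∈ nhds (u : ℂ) := isOpen_compl_singleton.mem_nhds u.ne_zero
      have h : extendZero (f.1 * g.1) = extendZero f.1 * extendZero g.1 := by
        ext z
        by_cases hz : z = 0 <;> simp [extendZero, hz]
      have hd := deriv_mul (f.2.differentiableAt hu) (g.2.differentiableAt hu)
      change τ * u * deriv (extendZero (f.1 * g.1)) u =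
        f.1 u * (τ * u * deriv (extendZero g.1) u) + g.1 u * (τ * u * deriv (extendZero f.1) u)
      rw [h, hd, extendZero_coe, extendZero_coe]
      ring)

/-- `z⁻¹ f` has at most a simple pole at the origin. -/
def AtMostSimplePole (f : OCstar) : Prop :=
  MeromorphicAt (fun z : ℂ => z⁻¹ * extendZero f.1 z) 0 ∧
    ((-1 : ℤ) : WithTop ℤ) ≤ meromorphicOrderAt (fun z : ℂ => z⁻¹ * extendZero f.1 z) 0

/-- Objects of `ℬ_q`: finitely presentable `𝒪(ℂ*)`-modules `M` with a representation of the
infinite cyclic group `θℤ` covering its action on `𝒪(ℂ*)`. The representation is given by the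
automorphism `σ` by which the generator `θ` acts. Its `ℂ`-linearity follows from `σ_smul`, since
`α` fixes the constants. -/
structure Bq (θ : ℝ) where
  carrier : Type w
  [addCommGroup : AddCommGroup carrier]
  [module : Module OCstar carrier]
  finitePresentation : Module.FinitePresentation OCstar carrier
  σ : carrier ≃+ carrier
  σ_smul : ∀ (f : OCstar) (m : carrier), σ (f • m) = alpha θ f • σ m

namespace Bq

variable {θ : ℝ}

instance : CoeSort (Bq.{w} θ) (Type w) := ⟨Bq.carrier⟩

instance (M : Bq.{w} θ) : AddCommGroup M := M.addCommGroup

instance (M : Bq.{w} θ) : Module OCstar M := M.module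

/-- Morphisms of `ℬ_q`: equivariant `𝒪(ℂ*)`-linear maps. -/
@[ext]
structure Hom (M N : Bq.{w} θ) where
  lin : M →ₗ[OCstar] N
  equivariant : ∀ m : M, lin (M.σ m) = N.σ (lin m)

instance : Category (Bq.{w} θ) where
  Hom M N := Hom M N
  id M := ⟨LinearMap.id, fun _ => rfl⟩
  comp f g := ⟨g.lin ∘ₗ f.lin, fun m => by simp [f.equivariant, g.equivariant]⟩

@[ext]
theorem hom_ext {M N : Bq.{w} θ} {f g : M ⟶ N} (h : f.lin = g.lin) : f = g := Hom.ext h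

@[simp]
theorem id_lin (M : Bq.{w} θ) : Hom.lin (𝟙 M) = LinearMap.id := rfl

@[simp]
theorem comp_lin {M N P : Bq.{w} θ} (f : M ⟶ N) (g : N ⟶ P) :
    Hom.lin (f ≫ g) = g.lin ∘ₗ f.lin := rfl

section

variable {M N : Bq.{w} θ}

instance : Zero (M ⟶ N) := ⟨⟨0, fun m => by simp⟩⟩

instance : Add (M ⟶ N) := ⟨fun f g => ⟨f.lin + g.lin, fun m => by
  simp [f.equivariant, g.equivariant]⟩⟩

instance : Neg (M ⟶ N) := ⟨fun f => ⟨-f.lin, fun m => by simp [f.equivariant]⟩⟩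

instance : Sub (M ⟶ N) := ⟨fun f g => ⟨f.lin - g.lin, fun m => by
  simp [f.equivariant, g.equivariant]⟩⟩

instance : SMul ℕ (M ⟶ N) := ⟨fun n f => ⟨n • f.lin, fun m => by simp [f.equivariant]⟩⟩

instance : SMul ℤ (M ⟶ N) := ⟨fun n f => ⟨n • f.lin, fun m => by simp [f.equivariant]⟩⟩

instance : AddCommGroup (M ⟶ N) :=
  Function.Injective.addCommGroup (fun f : M ⟶ N => f.lin) (fun _ _ h => hom_ext h)
    rfl (fun _ _ => rfl) (fun _ => rfl) (fun _ _ => rfl) (fun _ _ => rfl) (fun _ _ => rfl)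

@[simp]
theorem add_lin (f g : M ⟶ N) : Hom.lin (f + g) = f.lin + g.lin := rfl

@[simp]
theorem zero_lin : Hom.lin (0 : M ⟶ N) = 0 := rfl

end

/-- Morphisms are added pointwise. -/
instance : Preadditive (Bq.{w} θ) where
  add_comp _ _ _ f g h := by
    apply hom_ext
    simp [LinearMap.comp_add]
  comp_add _ _ _ f g h := by
    apply hom_ext
    simp [LinearMap.add_comp]

end Bq

/-- `θℤ`-equivariant connections on `M` covering the derivation `δ = τ z d/dz`. Their
`ℂ`-linearity follows from `leibniz`, since `δ` kills the constants. -/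
@[ext]
structure Connection {θ : ℝ} (τ : ℂ) (M : Bq.{w} θ) where
  nabla : M →+ M
  leibniz : ∀ (f : OCstar) (m : M), nabla (f • m) = f • nabla m + delta τ f • m
  equivariant : ∀ m : M, nabla (M.σ m) = M.σ (nabla m)

/-- The connection is regular singular: in some module basis `e`, with
`∇ (e i) = ∑ j, A i j • e j`, the functions `z⁻¹ A i j` have at most simple poles at `0`. -/
def Connection.IsRegularSingular {θ : ℝ} {τ : ℂ} {M : Bq.{w} θ} (D : Connection τ M) : Prop :=
  ∃ (n : ℕ) (e : Module.Basis (Fin n) OCstar M),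
    ∀ i j : Fin n, AtMostSimplePole (e.repr (D.nabla (e i)) j)

/-- A morphism of `ℬ_q` is compatible with connections on its source and target. -/
def Compatible {θ : ℝ} {τ : ℂ} {M N : Bq.{w} θ} (D : Connection τ M) (E : Connection τ N)
    (f : M ⟶ N) : Prop :=
  ∀ m : M, f.lin (D.nabla m) = E.nabla (f.lin m)

/-- Objects of `ℬ_q^τ`. -/
structure BqTau (θ : ℝ) (τ : ℂ) where
  toBq : Bq.{w} θ
  conn : Connection τ toBq
  regularSingular : conn.IsRegularSingular

namespace BqTau

variable {θ : ℝ} {τ : ℂ}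

/-- Morphisms of `ℬ_q^τ`: equivariant module maps compatible with the connections. -/
@[ext]
structure Hom (M N : BqTau.{w} θ τ) where
  toBq : M.toBq ⟶ N.toBq
  compatible : Compatible M.conn N.conn toBq

instance : Category (BqTau.{w} θ τ) where
  Hom M N := Hom M N
  id M := ⟨𝟙 M.toBq, fun _ => rfl⟩
  comp {M N P} f g := ⟨f.toBq ≫ g.toBq, fun m =>
    (congrArg g.toBq.lin (f.compatible m)).trans (g.compatible (f.toBq.lin m))⟩

@[ext]
theorem hom_ext {M N : BqTau.{w} θ τ} {f g : M ⟶ N} (h : f.toBq = g.toBq) : f = g := Hom.ext h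

/-- A compatible morphism of `ℬ_q` as a morphism of `ℬ_q^τ`. -/
def homMk {M N : BqTau.{w} θ τ} (f : M.toBq ⟶ N.toBq) (h : Compatible M.conn N.conn f) :
    M ⟶ N :=
  ⟨f, h⟩

/-- The functor `ℬ_q^τ ⥤ ℬ_q` which forgets the connection. -/
def forget (θ : ℝ) (τ : ℂ) : BqTau.{w} θ τ ⥤ Bq.{w} θ where
  obj M := M.toBq
  map f := f.toBq

section

variable {M N : BqTau.{w} θ τ}

instance : Zero (M ⟶ N) := ⟨⟨0, fun m => by simp⟩⟩

instance : Add (M ⟶ N) := ⟨fun f g => ⟨f.toBq + g.toBq, fun m => by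
  have h1 := f.compatible m
  have h2 := g.compatible m
  simp [h1, h2]⟩⟩

instance : Neg (M ⟶ N) := ⟨fun f => ⟨-f.toBq, fun m => by
  have h1 := f.compatible m
  change -(f.toBq.lin _) = N.conn.nabla (-(f.toBq.lin m))
  simp [h1]⟩⟩

instance : Sub (M ⟶ N) := ⟨fun f g => ⟨f.toBq - g.toBq, fun m => by
  have h1 := f.compatible m
  have h2 := g.compatible m
  change f.toBq.lin _ - g.toBq.lin _ = N.conn.nabla (f.toBq.lin m - g.toBq.lin m)
  simp [h1, h2]⟩⟩

instance : SMul ℕ (M ⟶ N) := ⟨fun n f => ⟨n • f.toBq, fun m => by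
  have h1 := f.compatible m
  change n • (f.toBq.lin _) = N.conn.nabla (n • (f.toBq.lin m))
  simp [h1]⟩⟩

instance : SMul ℤ (M ⟶ N) := ⟨fun n f => ⟨n • f.toBq, fun m => by
  have h1 := f.compatible m
  change n • (f.toBq.lin _) = N.conn.nabla (n • (f.toBq.lin m))
  simp [h1]⟩⟩

instance : AddCommGroup (M ⟶ N) :=
  Function.Injective.addCommGroup (fun f : M ⟶ N => f.toBq) (fun _ _ h => hom_ext h)
    rfl (fun _ _ => rfl) (fun _ => rfl) (fun _ _ => rfl) (fun _ _ => rfl) (fun _ _ => rfl)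

end

/-- Morphisms are added pointwise. -/
instance : Preadditive (BqTau.{w} θ τ) where
  add_comp _ _ _ f g h := hom_ext (Preadditive.add_comp _ _ _ f.toBq g.toBq h.toBq)
  comp_add _ _ _ f g h := hom_ext (Preadditive.comp_add _ _ _ f.toBq g.toBq h.toBq)

end BqTau

end NCEllipticCurve

end

open NCEllipticCurve

/-! The crux is that a horizontal map f : M → N between finite free modules with connection has free
kernel and free cokernel over 𝒪(ℂ*). This follows from Floquet theory, done uniformly for the
connection and for all its horizontal endomorphisms.

Pull back along z = exp w. The connection becomes a linear system on ℂ with entire coefficients of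
period c = 2πi, and its fundamental solution satisfies Φ(w + c) = Φ(c) Φ(w). If exp X = Φ(c)⁻¹ and Λ
= X / c, then P(w) = exp(wΛ) Φ(w) is periodic, so it descends to an invertible matrix over 𝒪(ℂ*),
and in the corresponding basis the connection has a constant matrix. A horizontal endomorphism F
satisfies Φ F = F(0) Φ, so F(0) commutes with the monodromy Φ(c). Choosing X in the bicommutant of
the monodromy (`exists_log`) makes F(0) commute with exp(wΛ) as well, so F too is constant in the
new basis (`exists_gauge`, `exists_constant_basis`).

On M × N the projection to M and the map induced by f are horizontal endomorphisms, hence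
simultaneously constant. Kernels and cokernels of constant matrices come from complex vector spaces
by extension of scalars, so they are free (`exists_basis_ker_of_horizontal`,
`exists_basis_coker_of_horizontal`).

A constant matrix divided by z has at most a simple pole, so every connection on a finite free
module is regular singular (`Connection.isRegularSingular_of_basis`). The connections induced on
kernels and cokernels therefore stay in the category. Monomorphisms are then injective and
epimorphisms surjective, hence normal, and the category is abelian. -/

namespace NCEllipticCurve

/-! ### Linear algebra: extension of scalars and maps with constant matrices -/

section ConstantForms

open Module

variable {k R M N ι ι' κ : Type*} [Field k] [CommRing R] [Algebra k R]
  [AddCommGroup M] [Module R M] [Module k M] [IsScalarTower k R M]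
  [AddCommGroup N] [Module R N] [Module k N] [IsScalarTower k R N]

theorem map_mem_span_of_basis {e : Basis ι R M} {e' : Basis ι' R N} {g : M →ₗ[R] N}
    (hg : ∀ i, g (e i) ∈ Submodule.span k (Set.range e')) {x : M}
    (hx : x ∈ Submodule.span k (Set.range e)) : g x ∈ Submodule.span k (Set.range e') := by
  have : Submodule.span k (Set.range e) ≤
      (Submodule.span k (Set.range e')).comap (g.restrictScalars k) := by
    rw [Submodule.span_le]
    rintro _ ⟨i, rfl⟩
    exact hg i
  exact this hx

variable [Nontrivial R]

theorem linearIndependent_scalars (e : Basis ι R M) : LinearIndependent k e :=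
  e.linearIndependent.restrict_scalars' k

/-- A `k`-basis of the `k`-span of an `R`-basis is an `R`-basis. -/
theorem exists_basis_of_basis_span (e : Basis ι R M)
    (c : Basis κ k (Submodule.span k (Set.range e))) :
    ∃ b : Basis κ R M, (∀ i, b i = c i) ∧
      ∀ (x : Submodule.span k (Set.range e)) i, b.repr x i = algebraMap k R (c.repr x i) := by
  classical
  let eW := Basis.span (linearIndependent_scalars (k := k) e)
  -- `E` is the isomorphism R ⊗ W ≅ M, with W the k-span of `e`; through it every k-basis of W
  -- base-changes to an R-basis of M.
  let E := (eW.baseChange R).equiv e (Equiv.refl _)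
  have hE : ∀ w : Submodule.span k (Set.range e), E (1 ⊗ₜ w) = w := by
    intro w
    have h : (E.toLinearMap.restrictScalars k) ∘ₗ (TensorProduct.mk k R _ 1) =
        (Submodule.span k (Set.range e)).subtype := by
      refine eW.ext fun i => ?_
      have := (eW.baseChange R).equiv_apply (b' := e) i (Equiv.refl _)
      rw [Basis.baseChange_apply] at this
      simpa [E, eW, Basis.span_apply] using this
    exact LinearMap.congr_fun h w
  refine ⟨(c.baseChange R).map E, fun i => by simp [hE], fun x i => ?_⟩
  have : E.symm x = 1 ⊗ₜ x := by rw [LinearEquiv.symm_apply_eq, hE]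
  simp [this, Algebra.algebraMap_eq_smul_one]

/-- An independent family over the field k extends to a k-basis of the span, which is also an
R-basis of M. -/
theorem linearIndependent_of_scalars (e : Basis ι R M)
    {v : κ → Submodule.span k (Set.range e)} (hv : LinearIndependent k v) :
    LinearIndependent R (fun i => (v i : M)) := by
  obtain ⟨b, hb, -⟩ := exists_basis_of_basis_span e (Basis.extend hv.linearIndepOn_id)
  have h := b.linearIndependent.comp
    (fun i => (⟨v i, hv.linearIndepOn_id.subset_extend _ (Set.mem_range_self i)⟩ :
      hv.linearIndepOn_id.extend (Set.subset_univ _)))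
    (fun i j hij => hv.injective (congrArg Subtype.val hij))
  convert h using 2 with i
  simp [hb]

/-- The kernel of a map with constant matrix is free. -/
theorem exists_basis_ker [Finite ι] (e : Basis ι R M) (e' : Basis ι' R N) (g : M →ₗ[R] N)
    (hg : ∀ i, g (e i) ∈ Submodule.span k (Set.range e')) :
    ∃ n : ℕ, Nonempty (Basis (Fin n) R (LinearMap.ker g)) := by
  classical
  set W := Submodule.span k (Set.range e) with hW
  set W' := Submodule.span k (Set.range e') with hW'
  have : FiniteDimensional k W := FiniteDimensional.span_of_finite k (Set.finite_range e)
  let gW : W →ₗ[k] W' := (g.restrictScalars k).restrict fun x hx => map_mem_span_of_basis hg hx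
  have hgW : ∀ w : W, (gW w : N) = g w := fun w => rfl
  obtain ⟨C, hC⟩ := Submodule.exists_isCompl (LinearMap.ker gW)
  let kb := finBasis k (LinearMap.ker gW)
  let cb := finBasis k C
  -- A k-basis adapted to the splitting of W into the kernel and a complement. Over R the first
  -- block is killed by `g` and the second has independent images, so the kernel is spanned by the
  -- first block.
  let c := (kb.prod cb).map (Submodule.prodEquivOfIsCompl _ _ hC)
  obtain ⟨b, hb, -⟩ := exists_basis_of_basis_span e c
  have hbl : ∀ i, b (Sum.inl i) = (kb i : W) := by intro i; simp [hb, c]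
  have hbr' : ∀ i, b (Sum.inr i) = (cb i : W) := by intro i; simp [hb, c]
  have hbk : ∀ i, g (b (Sum.inl i)) = 0 := by
    intro i
    rw [hbl, ← hgW]
    simp
  have hli : LinearIndependent R (fun j => g (b (Sum.inr j))) := by
    have h1 : LinearIndependent k (fun j => gW (cb j)) := by
      have := (cb.linearIndependent.map' C.subtype (Submodule.ker_subtype C)).map (f := gW) (by
        refine Disjoint.mono_left ?_ hC.disjoint.symm
        rw [Submodule.span_le]
        rintro _ ⟨i, rfl⟩
        exact (cb i).2)
      exact this
    have h2 := linearIndependent_of_scalars e' h1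
    convert h2 using 2 with j
    rw [hbr', hgW]
  let Ψ : LinearMap.ker g →ₗ[R] (Fin (finrank k (LinearMap.ker gW)) → R) :=
    (LinearMap.pi fun i => b.coord (Sum.inl i)) ∘ₗ (LinearMap.ker g).subtype
  have hΨ : ∀ x i, Ψ x i = b.repr x (Sum.inl i) := fun x i => rfl
  have hinj : Function.Injective Ψ := by
    rw [← LinearMap.ker_eq_bot, LinearMap.ker_eq_bot']
    intro x hx
    have hx1 : ∀ i, b.repr x (Sum.inl i) = 0 := fun i => by rw [← hΨ, hx]; rfl
    have hx2 : (x : M) = ∑ j, b.repr x (Sum.inr j) • b (Sum.inr j) := by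
      have := (b.sum_repr (x : M)).symm
      simpa only [Fintype.sum_sum_type, hx1, zero_smul, Finset.sum_const_zero, zero_add] using this
    have hx3 : ∑ j, b.repr x (Sum.inr j) • g (b (Sum.inr j)) = 0 := by
      have := x.2
      rw [LinearMap.mem_ker, hx2, map_sum] at this
      simpa using this
    have hx4 := Fintype.linearIndependent_iff.1 hli _ hx3
    apply Subtype.ext
    rw [hx2]
    simp [hx4]
  have hsurj : Function.Surjective Ψ := by
    intro a
    refine ⟨⟨∑ i, a i • b (Sum.inl i), ?_⟩, ?_⟩
    · simp [map_sum, hbk]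
    · ext i
      rw [hΨ]
      simp [Finsupp.single_apply]
  exact ⟨_, ⟨Basis.ofEquivFun (LinearEquiv.ofBijective Ψ ⟨hinj, hsurj⟩)⟩⟩

/-- The cokernel of a map with constant matrix is free. -/
theorem exists_basis_coker [Finite ι'] (e : Basis ι R M) (e' : Basis ι' R N) (g : M →ₗ[R] N)
    (hg : ∀ i, g (e i) ∈ Submodule.span k (Set.range e')) :
    ∃ n : ℕ, Nonempty (Basis (Fin n) R (N ⧸ LinearMap.range g)) := by
  classical
  set W := Submodule.span k (Set.range e) with hW
  set W' := Submodule.span k (Set.range e') with hW'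
  have : FiniteDimensional k W' := FiniteDimensional.span_of_finite k (Set.finite_range e')
  let gW : W →ₗ[k] W' := (g.restrictScalars k).restrict fun x hx => map_mem_span_of_basis hg hx
  have hgW : ∀ w : W, (gW w : N) = g w := fun w => rfl
  obtain ⟨D, hD⟩ := Submodule.exists_isCompl (LinearMap.range gW)
  let rb := finBasis k (LinearMap.range gW)
  let db := finBasis k D
  -- A k-basis adapted to a complement of the range. The coordinates along the complement form `Φ`,
  -- whose kernel is the range of `g` over R.
  let c := (db.prod rb).map (Submodule.prodEquivOfIsCompl _ _ hD.symm)
  obtain ⟨b, hb, hbr⟩ := exists_basis_of_basis_span e' c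
  have hbl : ∀ i, b (Sum.inl i) = (db i : W') := by intro i; simp [hb, c]
  have hbr' : ∀ i, b (Sum.inr i) = (rb i : W') := by intro i; simp [hb, c]
  let Φ : N →ₗ[R] (Fin (finrank k D) → R) := LinearMap.pi fun i => b.coord (Sum.inl i)
  have hΦ : ∀ x i, Φ x i = b.repr x (Sum.inl i) := fun x i => rfl
  have hker : LinearMap.range g = LinearMap.ker Φ := by
    apply le_antisymm
    · have : Φ ∘ₗ g = 0 := by
        refine e.ext fun j => ?_
        ext i
        have hj : e j ∈ W := Submodule.subset_span ⟨j, rfl⟩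
        have h1 : g (e j) = gW ⟨e j, hj⟩ := rfl
        have h2 : c.repr (gW ⟨e j, hj⟩) (Sum.inl i) = 0 := by
          have : (Submodule.prodEquivOfIsCompl _ _ hD.symm).symm (gW ⟨e j, hj⟩) =
              (0, ⟨gW ⟨e j, hj⟩, ⟨_, rfl⟩⟩) := by
            rw [LinearEquiv.symm_apply_eq]
            simp
          simp [c, this]
        rw [LinearMap.comp_apply, hΦ, h1, hbr, h2]
        simp
      rw [LinearMap.range_le_ker_iff]
      exact this
    · intro x hx
      have hx1 : ∀ i, b.repr x (Sum.inl i) = 0 := fun i => by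
        rw [← hΦ, LinearMap.mem_ker.1 hx]; rfl
      rw [← b.sum_repr x]
      simp only [Fintype.sum_sum_type, hx1, zero_smul, Finset.sum_const_zero, zero_add]
      refine Submodule.sum_mem _ fun j _ => Submodule.smul_mem _ _ ?_
      rw [hbr']
      obtain ⟨w, hw⟩ := (rb j).2
      rw [← hw, hgW]
      exact ⟨_, rfl⟩
  have hsurj : Function.Surjective Φ := by
    intro a
    refine ⟨∑ i, a i • b (Sum.inl i), ?_⟩
    ext i
    rw [hΦ]
    simp [Finsupp.single_apply]
  exact ⟨_, ⟨Basis.ofEquivFun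
    ((Submodule.quotEquivOfEq _ _ hker).trans (Φ.quotKerEquivOfSurjective hsurj))⟩⟩

end ConstantForms

/-! ### Linear differential equations with entire coefficients -/

section EntireODE

open Finset

variable {A : Type*} [NormedRing A] [NormedAlgebra ℂ A]

/-- Taylor coefficients of the solution of `Y' = b Y`, `Y 0 = 1`, where `b` has Taylor
coefficients `β`. -/
noncomputable def odeCoeff (β : ℕ → A) : ℕ → A
  | 0 => 1
  | n + 1 => ((n : ℂ) + 1)⁻¹ • ∑ k ∈ range (n + 1), β k * odeCoeff β (n - k)
decreasing_by exact Nat.lt_succ_of_le (Nat.sub_le n k)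

theorem odeCoeff_succ (β : ℕ → A) (n : ℕ) :
    ((n : ℂ) + 1) • odeCoeff β (n + 1) = ∑ k ∈ range (n + 1), β k * odeCoeff β (n - k) := by
  rw [odeCoeff, smul_smul, mul_inv_cancel₀ (Nat.cast_add_one_ne_zero n), one_smul]

/-- The factor 1/(n+1) in the recursion beats any fixed growth constant: the weighted partial sums
`U` at most double at each step once n + 1 exceeds R C. The radius R = 2r then absorbs the resulting
2 ^ n. -/
theorem exists_norm_odeCoeff_le (β : ℕ → A)
    (hβ : ∀ R : ℝ, 0 < R → ∃ C, ∀ k, ‖β k‖ * R ^ k ≤ C) {r : ℝ} (hr : 0 < r) :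
    ∃ c, ∀ n, ‖odeCoeff β n‖ * r ^ n ≤ c := by
  obtain ⟨C, hC⟩ := hβ (2 * r) (by positivity)
  set R := 2 * r with hR
  have hR0 : 0 < R := by positivity
  have hC0 : 0 ≤ C := le_trans (by positivity) (hC 0)
  let U : ℕ → ℝ := fun n => ∑ j ∈ range (n + 1), ‖odeCoeff β j‖ * R ^ j
  have hU0 : ∀ n, 0 ≤ U n := fun n => Finset.sum_nonneg fun j _ => by positivity
  have hUs : ∀ n, U (n + 1) = U n + ‖odeCoeff β (n + 1)‖ * R ^ (n + 1) := fun n =>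
    Finset.sum_range_succ _ _
  -- The bound ‖β k‖ R ^ k ≤ C reduces the convolution in the recursion to a partial sum.
  have hstep : ∀ n : ℕ, ((n : ℝ) + 1) * (‖odeCoeff β (n + 1)‖ * R ^ (n + 1)) ≤ R * C * U n := by
    intro n
    have h1 : ((n : ℝ) + 1) * ‖odeCoeff β (n + 1)‖ =
        ‖∑ k ∈ range (n + 1), β k * odeCoeff β (n - k)‖ := by
      rw [← odeCoeff_succ, norm_smul]
      congr 1
      norm_cast
    have h2 : ‖∑ k ∈ range (n + 1), β k * odeCoeff β (n - k)‖ * R ^ n ≤ C * U n := by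
      have h3 : C * U n = ∑ k ∈ range (n + 1), C * (‖odeCoeff β (n - k)‖ * R ^ (n - k)) := by
        rw [← Finset.mul_sum]
        congr 1
        have := Finset.sum_range_reflect (fun j => ‖odeCoeff β j‖ * R ^ j) (n + 1)
        simp only [Nat.add_sub_cancel] at this
        rw [this]
      rw [h3]
      refine (mul_le_mul_of_nonneg_right (norm_sum_le _ _) (by positivity)).trans ?_
      rw [Finset.sum_mul]
      refine Finset.sum_le_sum fun k hk => ?_
      have hk' : k ≤ n := Nat.lt_succ_iff.1 (mem_range.1 hk)
      calc ‖β k * odeCoeff β (n - k)‖ * R ^ n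
          ≤ (‖β k‖ * ‖odeCoeff β (n - k)‖) * R ^ n := by gcongr; exact norm_mul_le _ _
        _ = (‖β k‖ * R ^ k) * (‖odeCoeff β (n - k)‖ * R ^ (n - k)) := by
            rw [← Nat.add_sub_of_le hk', pow_add]
            simp only [Nat.add_sub_cancel_left]
            ring
        _ ≤ C * (‖odeCoeff β (n - k)‖ * R ^ (n - k)) := by gcongr; exact hC k
    calc ((n : ℝ) + 1) * (‖odeCoeff β (n + 1)‖ * R ^ (n + 1))
        = R * ((((n : ℝ) + 1) * ‖odeCoeff β (n + 1)‖) * R ^ n) := by ring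
      _ ≤ R * (C * U n) := by rw [h1]; gcongr
      _ = R * C * U n := by ring
  obtain ⟨n₀, hn₀⟩ := exists_nat_ge (R * C)
  have hmono : Monotone U := monotone_nat_of_le_succ fun n => by
    rw [hUs]
    have : 0 ≤ ‖odeCoeff β (n + 1)‖ * R ^ (n + 1) := by positivity
    linarith
  have hbound : ∀ n, U n ≤ U n₀ * 2 ^ n := by
    intro n
    induction n with
    | zero => simpa using hmono (Nat.zero_le n₀)
    | succ n ih =>
      rcases le_total (n + 1) n₀ with h | h
      · refine (hmono h).trans ?_
        exact le_mul_of_one_le_right (hU0 _) (one_le_pow₀ (by norm_num))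
      · have h1 := hstep n
        have h2 : R * C ≤ (n : ℝ) + 1 := hn₀.trans (by exact_mod_cast h)
        have h3 : ‖odeCoeff β (n + 1)‖ * R ^ (n + 1) ≤ U n := by
          refine le_of_mul_le_mul_left (h1.trans ?_) (by positivity : (0 : ℝ) < (n : ℝ) + 1)
          exact mul_le_mul_of_nonneg_right h2 (hU0 n)
        rw [hUs, pow_succ (2 : ℝ)]
        linarith
  refine ⟨U n₀, fun n => ?_⟩
  have h1 : ‖odeCoeff β n‖ * R ^ n ≤ U n :=
    Finset.single_le_sum (f := fun j => ‖odeCoeff β j‖ * R ^ j) (fun j _ => by positivity)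
      (mem_range.2 (Nat.lt_succ_self n))
  have h2 := h1.trans (hbound n)
  rw [hR, mul_pow] at h2
  have h3 : (0 : ℝ) < 2 ^ n := by positivity
  refine le_of_mul_le_mul_right ?_ h3
  linarith

/-- An entire function is the sum of an everywhere absolutely convergent power series. -/
theorem exists_entire_coeff [CompleteSpace A] {b : ℂ → A} (hb : Differentiable ℂ b) :
    ∃ β : ℕ → A, (∀ R : ℝ, 0 ≤ R → Summable fun k => ‖β k‖ * R ^ k) ∧
      ∀ w, b w = ∑' k, w ^ k • β k := by
  have hps := hb.hasFPowerSeriesOnBall 0 (R := 1) one_pos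
  generalize cauchyPowerSeries b 0 _ = p at hps
  have hrad : p.radius = ⊤ := top_le_iff.1 hps.r_le
  refine ⟨p.coeff, fun R hR => ?_, fun w => ?_⟩
  · lift R to NNReal using hR
    have := p.summable_norm_mul_pow (r := R) (by rw [hrad]; exact ENNReal.coe_lt_top)
    simpa using this
  · have := hps.hasSum (y := w) (by simp)
    rw [zero_add] at this
    rw [← this.tsum_eq]
    congr 1
    ext k
    simp

/-- A bound at radius 2s leaves a factor (1/2) ^ n at radius s, which outweighs the n produced by
differentiation. -/
theorem summable_derivative_of_bound {a : ℕ → ℝ} (ha : ∀ n, 0 ≤ a n) {c s : ℝ} (hs : 0 < s)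
    (hc : ∀ n, a n * (2 * s) ^ n ≤ c) :
    Summable fun n : ℕ => (n : ℝ) * s ^ (n - 1) * a n := by
  have h0 : ‖(1 / 2 : ℝ)‖ < 1 := by norm_num
  have h1 := (summable_pow_mul_geometric_of_norm_lt_one 1 h0).mul_left (c / s)
  refine Summable.of_nonneg_of_le (fun n => by have := ha n; positivity) (fun n => ?_) h1
  rcases n with _ | n
  · simp
  · have h2 := hc (n + 1)
    rw [mul_pow] at h2
    have h3 : s ^ (n + 1) * a (n + 1) ≤ c * (1 / 2) ^ (n + 1) := by
      rw [one_div, inv_pow, ← div_eq_mul_inv, le_div_iff₀ (by positivity)]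
      linarith
    have h4 : s ^ n * a (n + 1) ≤ c * (1 / 2) ^ (n + 1) / s := by
      rw [le_div_iff₀ hs]
      calc s ^ n * a (n + 1) * s = s ^ (n + 1) * a (n + 1) := by ring
        _ ≤ _ := h3
    rw [Nat.add_sub_cancel, mul_assoc, pow_one]
    calc ((n + 1 : ℕ) : ℝ) * (s ^ n * a (n + 1))
        ≤ ((n + 1 : ℕ) : ℝ) * (c * (1 / 2) ^ (n + 1) / s) := by gcongr
      _ = c / s * (((n + 1 : ℕ) : ℝ) * (1 / 2) ^ (n + 1)) := by
        rw [div_mul_eq_mul_div, mul_div_assoc', mul_left_comm]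

theorem summable_derivative_odeCoeff {β : ℕ → A}
    (hβ : ∀ R : ℝ, 0 < R → ∃ C, ∀ k, ‖β k‖ * R ^ k ≤ C) {s : ℝ} (hs : 0 < s) :
    Summable fun n : ℕ => (n : ℝ) * s ^ (n - 1) * ‖odeCoeff β n‖ := by
  obtain ⟨c, hc⟩ := exists_norm_odeCoeff_le β hβ (r := 2 * s) (by positivity)
  exact summable_derivative_of_bound (fun n => norm_nonneg _) hs hc

theorem summable_odeCoeff {β : ℕ → A}
    (hβ : ∀ R : ℝ, 0 < R → ∃ C, ∀ k, ‖β k‖ * R ^ k ≤ C) (w : ℂ) :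
    Summable fun n => ‖w ^ n • odeCoeff β n‖ := by
  have h := summable_derivative_odeCoeff hβ (s := ‖w‖ + 1) (by positivity)
  generalize odeCoeff β = y at h ⊢
  have h' := (h.comp_injective (add_left_injective 1)).mul_left (‖w‖ + 1)
  rw [← summable_nat_add_iff 1]
  refine Summable.of_nonneg_of_le (fun n => norm_nonneg _) (fun n => ?_) h'
  rw [norm_smul, norm_pow]
  simp only [Function.comp, Nat.add_sub_cancel]
  have h1 : ‖w‖ ^ (n + 1) ≤ (‖w‖ + 1) ^ (n + 1) := by gcongr; linarith
  have h2 : (1 : ℝ) ≤ ((n + 1 : ℕ) : ℝ) := by simp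
  calc ‖w‖ ^ (n + 1) * ‖y (n + 1)‖ ≤ 1 * ((‖w‖ + 1) ^ (n + 1) * ‖y (n + 1)‖) := by
        rw [one_mul]; gcongr
    _ ≤ ((n + 1 : ℕ) : ℝ) * ((‖w‖ + 1) ^ (n + 1) * ‖y (n + 1)‖) := by gcongr
    _ = _ := by ring

/-- Linear differential equations with entire coefficients have entire solutions. -/
theorem exists_entire_solution [CompleteSpace A] {b : ℂ → A} (hb : Differentiable ℂ b) :
    ∃ Y : ℂ → A, Y 0 = 1 ∧ ∀ w, HasDerivAt Y (b w * Y w) w := by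
  obtain ⟨β, hβs, hbsum⟩ := exists_entire_coeff hb
  have hβ : ∀ R : ℝ, 0 < R → ∃ C, ∀ k, ‖β k‖ * R ^ k ≤ C := fun R hR =>
    ⟨_, fun k => (hβs R hR.le).le_tsum k fun j _ => by positivity⟩
  have hys := fun s hs => summable_derivative_odeCoeff hβ (s := s) hs
  have hys' := summable_odeCoeff hβ
  have hrec := odeCoeff_succ β
  have hy0 : odeCoeff β 0 = 1 := by rw [odeCoeff]
  generalize odeCoeff β = y at hys hys' hrec hy0
  refine ⟨fun w => ∑' n, w ^ n • y n, ?_, fun w => ?_⟩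
  · dsimp only
    rw [tsum_eq_single 0]
    · simp [hy0]
    · intro n hn
      simp [hn]
  · have hs : 0 < ‖w‖ + 1 := by positivity
    have hd := hasDerivAt_tsum_of_isPreconnected (𝕜 := ℂ) (hys _ hs)
      (t := Metric.ball (0 : ℂ) (‖w‖ + 1)) (g := fun n z => z ^ n • y n)
      (g' := fun n z => ((n : ℂ) * z ^ (n - 1)) • y n) (y := w) (y₀ := 0) Metric.isOpen_ball
      (convex_ball _ _).isPreconnected (fun n z _ => (hasDerivAt_pow n z).smul_const (y n))
      (fun n z hz => by
        rw [norm_smul, norm_mul, norm_pow, Complex.norm_natCast]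
        have : ‖z‖ ≤ ‖w‖ + 1 := by simpa using (Metric.mem_ball.1 hz).le
        gcongr)
      (by simp [hs]) (by
        refine summable_of_ne_finset_zero (s := {0}) fun n hn => ?_
        have : n ≠ 0 := by simpa using hn
        simp [this]) (by simp)
    refine hd.congr_deriv ?_
    rw [hbsum w]
    have hβw : Summable fun k => ‖w ^ k • β k‖ := by
      refine (hβs ‖w‖ (norm_nonneg _)).congr fun k => ?_
      rw [norm_smul, norm_pow, mul_comm]
    -- The Cauchy product of b and Y is compared coefficientwise with the derived series, whose n =
    -- 0 term vanishes; the match is the recursion.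
    rw [tsum_mul_tsum_eq_tsum_sum_range_of_summable_norm hβw (hys' w)]
    have hsum : Summable fun n : ℕ => ((n : ℂ) * w ^ (n - 1)) • y n := by
      refine Summable.of_norm_bounded (hys _ hs) fun n => ?_
      rw [norm_smul, norm_mul, norm_pow, Complex.norm_natCast]
      gcongr
      linarith
    rw [hsum.tsum_eq_zero_add]
    simp only [Nat.cast_zero, zero_mul, zero_smul, zero_add]
    congr 1
    ext n
    rw [Nat.add_sub_cancel, mul_comm, mul_smul, Nat.cast_add_one, hrec, Finset.smul_sum]
    refine Finset.sum_congr rfl fun k hk => ?_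
    have hk' : k ≤ n := Nat.lt_succ_iff.1 (mem_range.1 hk)
    rw [smul_mul_smul_comm, ← pow_add, Nat.add_sub_of_le hk']

end EntireODE

/-! ### Logarithms in finite-dimensional algebras -/

section Logarithm

open NormedSpace Set

/-- In a commutative Banach algebra, the end point of a segment of units from `1` has a
logarithm. -/
theorem exists_exp_eq_of_segment {B : Type*} [NormedCommRing B] [NormedAlgebra ℂ B]
    [CompleteSpace B] (a : B)
    (ha : ∀ t ∈ Icc (0 : ℝ) 1, IsUnit (1 + (t : ℂ) • (a - 1))) : ∃ x : B, exp x = a := by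
  let p : ℝ → ℝ := fun t => projIcc 0 1 zero_le_one t
  have hp : ∀ t, p t ∈ Icc (0 : ℝ) 1 := fun t => (projIcc 0 1 zero_le_one t).2
  have hp' : ∀ t ∈ Icc (0 : ℝ) 1, p t = t := fun t ht => by simp [p, projIcc_of_mem _ ht]
  have hpc : Continuous p := continuous_subtype_val.comp continuous_projIcc
  -- The logarithmic derivative of t ↦ 1 + t(a − 1). Clamping t to [0, 1] by `p` makes it continuous
  -- on all of ℝ, so that its integral `l` is differentiable everywhere.
  let R : ℝ → B := fun t => (a - 1) * Ring.inverse (1 + (p t : ℂ) • (a - 1))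
  have hR : Continuous R := by
    refine continuous_const.mul (continuous_iff_continuousAt.2 fun t => ?_)
    obtain ⟨u, hu⟩ := ha _ (hp t)
    have h1 : ContinuousAt Ring.inverse (1 + (p t : ℂ) • (a - 1)) := by
      rw [← hu]; exact NormedRing.inverse_continuousAt u
    have h2 : Continuous fun t => 1 + (p t : ℂ) • (a - 1) := by fun_prop
    exact ContinuousAt.comp (f := fun t => 1 + (p t : ℂ) • (a - 1)) h1 h2.continuousAt
  let l : ℝ → B := fun t => ∫ s in (0 : ℝ)..t, R s
  have hl : ∀ t, HasDerivAt l (R t) t := fun t =>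
    intervalIntegral.integral_hasDerivAt_right (hR.intervalIntegrable _ _)
      (hR.stronglyMeasurableAtFilter _ _) hR.continuousAt
  -- Commutativity of B makes this quotient have derivative zero on [0, 1]; comparing end points
  -- gives exp (l 1) = a.
  let g : ℝ → B := fun t => exp (-l t) * (1 + (t : ℂ) • (a - 1))
  have hg : ∀ t ∈ Icc (0 : ℝ) 1, HasDerivAt g 0 t := by
    intro t ht
    have h1 : HasDerivAt (fun t => exp (-l t)) (exp (-l t) * (-R t)) t := by
      have := (hasFDerivAt_exp (𝕂 := ℝ) (x := -l t)).comp_hasDerivAt t (hl t).neg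
      refine HasDerivAt.congr_deriv this ?_
      simp
    have h2 : HasDerivAt (fun t : ℝ => 1 + (t : ℂ) • (a - 1)) (a - 1) t := by
      have := ((Complex.ofRealCLM.hasDerivAt (x := t)).smul_const (a - 1)).const_add 1
      simpa using this
    refine (h1.mul h2).congr_deriv ?_
    have h3 : R t * (1 + (t : ℂ) • (a - 1)) = a - 1 := by
      simp only [R]
      rw [hp' t ht, mul_assoc, Ring.inverse_mul_cancel _ (ha t ht), mul_one]
    rw [mul_assoc, neg_mul, h3]
    ring
  have hconst := constant_of_has_deriv_right_zero (f := g) (a := 0) (b := 1)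
    (fun t ht => (hg t ht).continuousAt.continuousWithinAt)
    (fun t ht => (hg t (Ico_subset_Icc_self ht)).hasDerivWithinAt) 1 (by simp)
  have h0 : g 0 = 1 := by simp [g, l]
  have h1 : g 1 = exp (-l 1) * a := by simp [g]
  let : NormedAlgebra ℚ B := NormedAlgebra.restrictScalars ℚ ℂ B
  refine ⟨l 1, ?_⟩
  have h2 : exp (l 1) * exp (-l 1) = 1 := by rw [← exp_add]; simp
  calc exp (l 1) = exp (l 1) * (exp (-l 1) * a) := by rw [← h1, hconst, h0, mul_one]
    _ = a := by rw [← mul_assoc, h2, one_mul]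

/-- For a finite set of nonzero complex numbers there is a ray from the origin avoiding it. -/
theorem exists_ray_avoiding {S : Set ℂ} (hS : S.Finite) (h0 : (0 : ℂ) ∉ S) :
    ∃ c : ℂ, c ≠ 0 ∧ ∀ r : ℝ, (r : ℂ) * c ∉ S := by
  -- A slope `s` missed by all points of the finite set; the line of slope `s` meets S at most in 0,
  -- which is excluded.
  obtain ⟨s, hs⟩ := (hS.image fun μ : ℂ => μ.im / μ.re).exists_notMem
  refine ⟨1 + s * Complex.I, fun h => by simpa using congrArg Complex.re h, fun r hr => hs ?_⟩
  refine ⟨_, hr, ?_⟩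
  have hr0 : r ≠ 0 := by
    rintro rfl
    simp [h0] at hr
  simp [hr0]

variable {A : Type*} [NormedRing A] [NormedAlgebra ℂ A] [FiniteDimensional ℂ A]

/-- A unit of a finite-dimensional complex algebra has a logarithm in its bicommutant. -/
theorem exists_log {T : A} (hT : IsUnit T) (hfin : (spectrum ℂ T).Finite) :
    ∃ X : A, exp X = T ∧ ∀ S, Commute T S → Commute X S := by
  have : CompleteSpace A := FiniteDimensional.complete ℂ A
  obtain ⟨c, hc0, hc⟩ := exists_ray_avoiding hfin (spectrum.zero_notMem ℂ hT)
  -- Working in the commutative algebra generated by T allows the segment argument and puts the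
  -- logarithm in the bicommutant of T.
  let B := Algebra.adjoin ℂ {T}
  have : FiniteDimensional ℂ B := FiniteDimensional.finiteDimensional_subalgebra B
  let : NormedCommRing B :=
    { (inferInstance : NormedRing B) with
      mul_comm := by
        intro x y
        apply Subtype.ext
        exact (Algebra.commute_of_mem_adjoin_singleton_of_commute y.2
          (Algebra.commute_of_mem_adjoin_self x.2).symm) }
  have : CompleteSpace B := FiniteDimensional.complete ℂ B
  have : IsArtinianRing B := isArtinian_of_tower ℂ inferInstance
  let T' : B := ⟨T, Algebra.self_mem_adjoin_singleton ℂ T⟩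
  -- Inverses in A remain in B: a unit of A is a nonzerodivisor in the Artinian ring B.
  have hunit : ∀ x : B, IsUnit (x : A) → IsUnit x := by
    intro x hx
    apply IsArtinianRing.isUnit_of_mem_nonZeroDivisors
    rw [mem_nonZeroDivisors_iff_right]
    intro y hy
    apply Subtype.ext
    have : (y : A) * x = 0 := congrArg Subtype.val hy
    simpa using (hx.mul_left_eq_zero).1 this
  obtain ⟨x, hx⟩ := exists_exp_eq_of_segment (c⁻¹ • T') (by
    intro t ht
    apply hunit
    have : (((1 + (t : ℂ) • (c⁻¹ • T' - 1) : B)) : A) =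
        algebraMap ℂ A (1 - t) + (t : ℂ) • c⁻¹ • T := by
      simp [T', Algebra.algebraMap_eq_smul_one, smul_sub, sub_smul]
      abel
    rw [this]
    rcases eq_or_ne t 0 with rfl | ht0
    · simp
    · have ht0' : (t : ℂ) ≠ 0 := by exact_mod_cast ht0
      have h1 := hc (-((1 - t) / t))
      rw [spectrum.notMem_iff] at h1
      -- For t ≠ 0 the point of the segment from 1 to c⁻¹T is a nonzero multiple of μ − T with μ a
      -- real multiple of c, hence outside the spectrum.
      have h2 : algebraMap ℂ A (1 - t) + (t : ℂ) • c⁻¹ • T =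
          (-((t : ℂ) * c⁻¹)) • (algebraMap ℂ A ((-((1 - t) / t) : ℝ) * c) - T) := by
        rw [smul_sub, Algebra.algebraMap_eq_smul_one, Algebra.algebraMap_eq_smul_one, smul_smul,
          smul_smul, neg_smul, sub_neg_eq_add]
        congr 2
        push_cast
        field_simp
      rw [h2]
      exact h1.smul (Units.mk0 _ (neg_ne_zero.2 (mul_ne_zero ht0' (inv_ne_zero hc0)))))
  let : NormedAlgebra ℚ A := NormedAlgebra.restrictScalars ℚ ℂ A
  let : NormedAlgebra ℚ B := NormedAlgebra.restrictScalars ℚ ℂ B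
  have hx' : exp (x : A) = c⁻¹ • T := by
    have := map_exp (B.val : B →ₐ[ℂ] A) continuous_subtype_val x
    rw [hx] at this
    exact this.symm
  refine ⟨algebraMap ℂ A (Complex.log c) + x, ?_, fun S hS => ?_⟩
  · rw [exp_add_of_commute (Algebra.commutes _ _), hx', ← algebraMap_exp_comm,
      ← Complex.exp_eq_exp_ℂ, Complex.exp_log hc0, ← Algebra.smul_def, smul_inv_smul₀ hc0]
  · exact (Algebra.commute_algebraMap_left _ _).add_left
      (Algebra.commute_of_mem_adjoin_singleton_of_commute x.2 hS.symm).symm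

end Logarithm

/-! ### Floquet theory for periodic systems -/

section GaugeTransform

open NormedSpace
open scoped Matrix.Norms.Operator

variable {n : Type*} [Fintype n] [DecidableEq n]

theorem eq_of_hasDerivAt_zero {E : Type*} [NormedAddCommGroup E] [NormedSpace ℂ E] {f : ℂ → E}
    (hf : ∀ w, HasDerivAt f 0 w) (w : ℂ) : f w = f 0 :=
  is_const_of_deriv_eq_zero (fun w => (hf w).differentiableAt) (fun w => (hf w).deriv) w 0

/-- Fundamental solutions of `Φ' = Φ b`, with their inverses. -/
theorem exists_fundamental_solution {b : ℂ → Matrix n n ℂ} (hb : Differentiable ℂ b) :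
    ∃ Φ Ψ : ℂ → Matrix n n ℂ, Φ 0 = 1 ∧ (∀ w, Φ w * Ψ w = 1) ∧ (∀ w, Ψ w * Φ w = 1) ∧
      (∀ w, HasDerivAt Φ (Φ w * b w) w) ∧ ∀ w, HasDerivAt Ψ (-(b w * Ψ w)) w := by
  let tr : Matrix n n ℂ →L[ℂ] Matrix n n ℂ :=
    LinearMap.toContinuousLinearMap (Matrix.transposeLinearEquiv n n ℂ ℂ).toLinearMap
  have htr : ∀ X, tr X = X.transpose := fun X => rfl
  -- The existence theorem has the coefficient on the left, so Φ' = Φ b is solved by transposing.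
  obtain ⟨Y, hY0, hY⟩ := exists_entire_solution (b := fun w => (b w).transpose)
    (tr.differentiable.comp hb)
  obtain ⟨Ψ, hΨ0, hΨ⟩ := exists_entire_solution hb.neg
  have hΦ : ∀ w, HasDerivAt (fun w => (Y w).transpose) ((Y w).transpose * b w) w := by
    intro w
    have := tr.hasFDerivAt.comp_hasDerivAt w (hY w)
    refine HasDerivAt.congr_deriv this ((htr _).trans ?_)
    rw [Matrix.transpose_mul, Matrix.transpose_transpose]
  have h1 : ∀ w, (Y w).transpose * Ψ w = 1 := by
    intro w
    have := eq_of_hasDerivAt_zero (f := fun w => (Y w).transpose * Ψ w) (fun w => by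
      refine ((hΦ w).mul (hΨ w)).congr_deriv ?_
      simp [mul_assoc]) w
    rw [this, hY0, hΨ0, Matrix.transpose_one, one_mul]
  refine ⟨fun w => (Y w).transpose, Ψ, by simp [hY0], h1, fun w => mul_eq_one_comm.1 (h1 w), hΦ,
    fun w => (hΨ w).congr_deriv (by simp)⟩

/-- A differential system with periodic coefficients has a periodic gauge transformation to a
system with constant coefficients, in which every periodic horizontal endomorphism is
constant. -/
theorem exists_gauge {b : ℂ → Matrix n n ℂ} (hb : Differentiable ℂ b) {c : ℂ} (hc : c ≠ 0)
    (hper : Function.Periodic b c) :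
    ∃ (P Q : ℂ → Matrix n n ℂ) (Λ : Matrix n n ℂ), Differentiable ℂ Q ∧
      Function.Periodic P c ∧ Function.Periodic Q c ∧ (∀ w, P w * Q w = 1) ∧
      (∀ w, HasDerivAt P (Λ * P w + P w * b w) w) ∧
      ∀ F : ℂ → Matrix n n ℂ, Function.Periodic F c →
        (∀ w, HasDerivAt F (F w * b w - b w * F w) w) → ∀ w, P w * F w = F 0 * P w := by
  obtain ⟨Φ, Ψ, hΦ0, hΦΨ, hΨΦ, hΦ, hΨ⟩ := exists_fundamental_solution hb
  have huniq : ∀ Y : ℂ → Matrix n n ℂ, (∀ w, HasDerivAt Y (Y w * b w) w) →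
      ∀ w, Y w = Y 0 * Φ w := by
    intro Y hY w
    have hΨ0 : Ψ 0 = 1 := by simpa [hΦ0] using hΦΨ 0
    have := eq_of_hasDerivAt_zero (f := fun w => Y w * Ψ w) (fun w => by
      refine ((hY w).mul (hΨ w)).congr_deriv ?_
      simp [mul_assoc]) w
    rw [hΨ0, mul_one] at this
    rw [← this, mul_assoc, hΨΦ, mul_one]
  -- By periodicity of b the translate of Φ solves the same equation, so uniqueness makes Φ(c) the
  -- monodromy.
  have hshift : ∀ w, Φ (w + c) = Φ c * Φ w := by
    intro w
    have := huniq (fun w => Φ (w + c)) (fun w => by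
      have := (hΦ (w + c)).comp_add_const w c
      rwa [hper w] at this) w
    simpa using this
  -- The logarithm of the inverse monodromy: exp(wΛ) then compensates the factor Φ(c) picked up over
  -- a period.
  obtain ⟨X, hX, hXc⟩ := exists_log (T := Ψ c) ⟨⟨Ψ c, Φ c, hΨΦ c, hΦΨ c⟩, rfl⟩
    (Matrix.finite_spectrum _)
  let Λ : Matrix n n ℂ := c⁻¹ • X
  let E : ℂ → Matrix n n ℂ := fun w => exp (w • Λ)
  have hE : ∀ w, HasDerivAt E (Λ * E w) w := fun w => hasDerivAt_exp_smul_const' Λ w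
  let : NormedAlgebra ℚ (Matrix n n ℂ) := NormedAlgebra.restrictScalars ℚ ℂ _
  have hEadd : ∀ v w, E (v + w) = E v * E w := by
    intro v w
    simp only [E, add_smul]
    exact exp_add_of_commute (((Commute.refl Λ).smul_left v).smul_right w)
  have hEc : E c = Ψ c := by
    simp only [E, Λ, smul_inv_smul₀ hc]
    exact hX
  have hE0 : E 0 = 1 := by simp [E]
  have hEcomm : ∀ S, Commute (Φ c) S → ∀ w, Commute (E w) S := by
    intro S hS w
    have h1 : Commute (Ψ c) S := by
      have : Ψ c * (Φ c * S) * Ψ c = Ψ c * (S * Φ c) * Ψ c := by rw [hS.eq]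
      rw [← mul_assoc, hΨΦ, one_mul, mul_assoc, mul_assoc, hΦΨ, mul_one] at this
      exact this.symm
    exact (((hXc S h1).smul_left c⁻¹).smul_left w).exp_left
  have hPper : Function.Periodic (fun w => E w * Φ w) c := by
    intro w
    simp only
    rw [hEadd, hEc, hshift, mul_assoc, ← mul_assoc (Ψ c), hΨΦ, one_mul]
  have hinv : ∀ w, E w * Φ w * (Ψ w * E (-w)) = 1 := by
    intro w
    rw [mul_assoc, ← mul_assoc (Φ w), hΦΨ, one_mul, ← hEadd, add_neg_cancel, hE0]
  have hinv' : ∀ w, Ψ w * E (-w) * (E w * Φ w) = 1 := fun w => mul_eq_one_comm.1 (hinv w)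
  refine ⟨fun w => E w * Φ w, fun w => Ψ w * E (-w), Λ, ?_, hPper, fun w => ?_, hinv,
    fun w => ?_, fun F hF hFd w => ?_⟩
  · intro w
    exact (hΨ w).differentiableAt.mul
      ((hE (-w)).differentiableAt.comp w (differentiable_neg w))
  · have h1 := hinv (w + c)
    have h2 := hPper w
    simp only at h2 ⊢
    rw [h2] at h1
    -- Periodicity of the inverse Q follows from that of P: Q(w + c) = Q(w) P(w) Q(w + c), where
    -- P(w) = P(w + c).
    calc _ = Ψ w * E (-w) * (E w * Φ w) * (Ψ (w + c) * E (-(w + c))) := by rw [hinv', one_mul]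
      _ = _ := by rw [mul_assoc, h1, mul_one]
  · refine ((hE w).mul (hΦ w)).congr_deriv ?_
    simp only [mul_assoc]
  -- Horizontality makes Φ F another solution of Y' = Y b, so it equals F(0) Φ. At w = c,
  -- periodicity of F shows that F(0) commutes with the monodromy.
  · have h1 : ∀ w, Φ w * F w = F 0 * Φ w := by
      intro w
      have := huniq (fun w => Φ w * F w) (fun w => by
        refine ((hΦ w).mul (hFd w)).congr_deriv ?_
        simp [mul_sub, mul_assoc]) w
      simpa [hΦ0] using this
    have h2 : Commute (Φ c) (F 0) := by
      have := h1 c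
      have h3 := hF 0
      rw [zero_add] at h3
      rw [h3] at this
      exact this
    rw [mul_assoc, h1, ← mul_assoc, (hEcomm _ h2 w).eq, mul_assoc]

end GaugeTransform

/-! ### Pullback to the universal cover of the punctured plane -/

section UniversalCover

/-- Evaluation at `exp w`, a ring homomorphism `𝒪(ℂ*) → ℂ`. -/
noncomputable def evalExp (w : ℂ) : OCstar →+* ℂ :=
  (Pi.evalRingHom (fun _ : ℂˣ => ℂ) (Units.mk0 (Complex.exp w) (Complex.exp_ne_zero w))).comp
    OCstar.val.toRingHom

theorem evalExp_apply (w : ℂ) (f : OCstar) :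
    evalExp w f = extendZero f.1 (Complex.exp w) :=
  (extendZero_of_ne _ (Complex.exp_ne_zero w)).symm

theorem ext_evalExp {f g : OCstar} (h : ∀ w, evalExp w f = evalExp w g) : f = g := by
  apply Subtype.ext
  funext u
  have := h (Complex.log u)
  rwa [evalExp_apply, evalExp_apply, Complex.exp_log u.ne_zero, extendZero_coe,
    extendZero_coe] at this

theorem evalExp_periodic (f : OCstar) :
    Function.Periodic (fun w => evalExp w f) (2 * Real.pi * Complex.I) := by
  intro w
  simp only [evalExp_apply, Complex.exp_periodic w]

/-- By the chain rule, z = exp w turns z d/dz into d/dw, so δ becomes τ d/dw. -/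
theorem hasDerivAt_evalExp {τ : ℂ} (hτ : τ ≠ 0) (f : OCstar) (w : ℂ) :
    HasDerivAt (fun w => evalExp w f) (τ⁻¹ * evalExp w (delta τ f)) w := by
  have h0 := Complex.exp_ne_zero w
  have h1 := (f.2.differentiableAt (isOpen_compl_singleton.mem_nhds h0)).hasDerivAt
  have h2 := h1.comp w (Complex.hasDerivAt_exp w)
  refine (h2.congr_deriv ?_).congr_of_eventuallyEq (Filter.Eventually.of_forall fun z =>
    evalExp_apply z f)
  change _ = τ⁻¹ * (τ * Complex.exp w * deriv (extendZero f.1) (Complex.exp w))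
  field_simp

/-- Periodic entire functions descend to the punctured plane. -/
theorem exists_evalExp_eq {g : ℂ → ℂ} (hg : Differentiable ℂ g)
    (hper : Function.Periodic g (2 * Real.pi * Complex.I)) :
    ∃ f : OCstar, ∀ w, evalExp w f = g w := by
  have hexp : ∀ v w, Complex.exp v = Complex.exp w → g v = g w := by
    intro v w h
    obtain ⟨n, rfl⟩ := Complex.exp_eq_exp_iff_exists_int.1 h
    exact hper.int_mul n w
  have key : ∀ w, extendZero (fun u : ℂˣ => g (Complex.log u)) (Complex.exp w) = g w := by
    intro w
    rw [extendZero_of_ne _ (Complex.exp_ne_zero w)]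
    exact hexp _ _ (Complex.exp_log (Complex.exp_ne_zero w))
  refine ⟨⟨fun u => g (Complex.log u), fun z hz => ?_⟩, fun w => ?_⟩
  · have hz : z ≠ 0 := hz
    apply DifferentiableAt.differentiableWithinAt
    -- The principal logarithm jumps on the negative axis. Near z, log(x/z) + log z is a holomorphic
    -- branch, and periodicity makes g blind to the choice.
    have h1 : DifferentiableAt ℂ (fun x => g (Complex.log (x / z) + Complex.log z)) z := by
      refine hg.differentiableAt.comp z (DifferentiableAt.add_const _ ?_)
      refine DifferentiableAt.clog (differentiableAt_id.div_const z) ?_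
      simp [div_self hz]
    refine h1.congr_of_eventuallyEq ?_
    filter_upwards [isOpen_compl_singleton.mem_nhds hz] with x hx
    have hx : x ≠ 0 := hx
    rw [← key, Complex.exp_add, Complex.exp_log hz, Complex.exp_log (div_ne_zero hx hz),
      div_mul_cancel₀ _ hz]
  · rw [evalExp_apply]
    exact key w

end UniversalCover

/-! ### Bases with constant connection and constant horizontal endomorphisms -/

section ConstantBasis

open Module
open scoped Matrix.Norms.Operator

variable {ι : Type*} [Fintype ι] [DecidableEq ι]

theorem hasDerivAt_mapMatrix_evalExp {τ : ℂ} (hτ : τ ≠ 0) (X : Matrix ι ι OCstar) (w : ℂ) :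
    HasDerivAt (fun w => (evalExp w).mapMatrix X)
      (τ⁻¹ • (evalExp w).mapMatrix (X.map (delta τ))) w :=
  hasDerivAt_pi.2 fun i => hasDerivAt_pi.2 fun j => hasDerivAt_evalExp hτ (X i j) w

theorem mapMatrix_evalExp_periodic (X : Matrix ι ι OCstar) :
    Function.Periodic (fun w => (evalExp w).mapMatrix X) (2 * Real.pi * Complex.I) := by
  intro w
  ext i j
  exact evalExp_periodic (X i j) w

theorem ext_mapMatrix_evalExp {X Y : Matrix ι ι OCstar}
    (h : ∀ w, (evalExp w).mapMatrix X = (evalExp w).mapMatrix Y) : X = Y := by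
  ext1 i j
  exact ext_evalExp fun w => congrFun (congrFun (h w) i) j

theorem exists_mapMatrix_evalExp_eq {P : ℂ → Matrix ι ι ℂ} (hP : Differentiable ℂ P)
    (hper : Function.Periodic P (2 * Real.pi * Complex.I)) :
    ∃ X : Matrix ι ι OCstar, ∀ w, (evalExp w).mapMatrix X = P w := by
  have h : ∀ i j, ∃ f : OCstar, ∀ w, evalExp w f = P w i j := fun i j =>
    exists_evalExp_eq (fun w => differentiableAt_pi.1 (differentiableAt_pi.1 (hP w) i) j)
      fun w => by rw [hper w]
  choose X hX using h
  refine ⟨Matrix.of X, fun w => ?_⟩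
  ext i j
  exact hX i j w

theorem exists_basis_of_mul_eq_one {R M : Type*} [CommRing R] [AddCommGroup M] [Module R M]
    (e : Basis ι R M) {X Y : Matrix ι ι R} (h : X * Y = 1) :
    ∃ b : Basis ι R M, ∀ i, b i = ∑ j, X i j • e j := by
  have h' : Y * X = 1 := mul_eq_one_comm.1 h
  -- Rows of X hold the coordinates of the new vectors, whereas `Matrix.toLin` reads columns; hence
  -- the transposes.
  refine ⟨e.map (LinearEquiv.ofLinearMap (Matrix.toLin e e X.transpose)
    (Matrix.toLin e e Y.transpose) ?_ ?_), fun i => ?_⟩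
  · rw [← Matrix.toLin_mul, ← Matrix.transpose_mul, h', Matrix.transpose_one, Matrix.toLin_one]
  · rw [← Matrix.toLin_mul, ← Matrix.transpose_mul, h, Matrix.transpose_one, Matrix.toLin_one]
  · simp [Matrix.toLin_self]

theorem sum_scalar_smul_mem_span {κ R M : Type*} [Fintype κ] [AddCommGroup M]
    [Module ℂ M] [CommRing R] [Algebra ℂ R] [Module R M]
    [IsScalarTower ℂ R M] (v : κ → M) (c : κ → ℂ) :
    ∑ j, algebraMap ℂ R (c j) • v j ∈ Submodule.span ℂ (Set.range v) := by
  refine Submodule.sum_mem _ fun j _ => ?_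
  rw [algebraMap_smul]
  exact Submodule.smul_mem _ _ (Submodule.subset_span ⟨j, rfl⟩)

variable {M : Type*} [AddCommGroup M] [Module OCstar M] [Module ℂ M] [IsScalarTower ℂ OCstar M]

/-- A free module with connection over `𝒪(ℂ*)` has a basis in which the connection and all
horizontal endomorphisms have constant matrices. -/
theorem exists_constant_basis {τ : ℂ} (hτ : τ ≠ 0) (e : Basis ι OCstar M) (D : M →+ M)
    (hD : ∀ (f : OCstar) (m : M), D (f • m) = f • D m + delta τ f • m) :
    ∃ e' : Basis ι OCstar M, (∀ i, D (e' i) ∈ Submodule.span ℂ (Set.range e')) ∧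
      ∀ φ : M →ₗ[OCstar] M, (∀ m, φ (D m) = D (φ m)) →
        ∀ i, φ (e' i) ∈ Submodule.span ℂ (Set.range e') := by
  let a : Matrix ι ι OCstar := Matrix.of fun i j => e.repr (D (e i)) j
  have ha : ∀ i, D (e i) = ∑ j, a i j • e j := fun i => (e.sum_repr _).symm
  have hDsum : ∀ c : ι → OCstar, D (∑ j, c j • e j) =
      ∑ k, (∑ j, c j * a j k + delta τ (c k)) • e k := by
    intro c
    rw [map_sum]
    simp only [hD, ha, Finset.sum_add_distrib, add_smul, Finset.smul_sum, Finset.sum_smul,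
      smul_smul]
    rw [Finset.sum_comm]
  -- With this sign, P' = ΛP + Pb makes δX cancel X a up to the constant part: X a + δX = τΛX.
  let b : ℂ → Matrix ι ι ℂ := fun w => -(τ⁻¹ • (evalExp w).mapMatrix a)
  have hb : Differentiable ℂ b := fun w =>
    ((hasDerivAt_mapMatrix_evalExp hτ a w).differentiableAt.const_smul τ⁻¹).neg
  have hbper : Function.Periodic b (2 * Real.pi * Complex.I) := by
    intro w
    exact congrArg (fun Z => -(τ⁻¹ • Z)) (mapMatrix_evalExp_periodic a w)
  obtain ⟨P, Q, Λ, hQ, hPper, hQper, hPQ, hP, hF⟩ :=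
    exists_gauge hb (by simp [Real.pi_ne_zero]) hbper
  obtain ⟨X, hX⟩ := exists_mapMatrix_evalExp_eq (fun w => (hP w).differentiableAt) hPper
  obtain ⟨Y, hY⟩ := exists_mapMatrix_evalExp_eq hQ hQper
  have hXY : X * Y = 1 := ext_mapMatrix_evalExp fun w => by
    rw [map_mul, hX, hY, hPQ, map_one]
  obtain ⟨e', he'⟩ := exists_basis_of_mul_eq_one e hXY
  -- The rows of X are the new basis vectors, so a matrix of the form C X with C complex describes
  -- constant combinations of them.
  have hconst : ∀ (Z : Matrix ι ι OCstar) (C : Matrix ι ι ℂ),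
      (∀ w, (evalExp w).mapMatrix Z = C * P w) → ∀ i,
        ∑ k, Z i k • e k ∈ Submodule.span ℂ (Set.range e') := by
    intro Z C h i
    have hZ : Z = C.map (algebraMap ℂ OCstar) * X := ext_mapMatrix_evalExp fun w => by
      rw [map_mul, hX, h]
      rfl
    have : ∑ k, Z i k • e k = ∑ j, algebraMap ℂ OCstar (C i j) • e' j := by
      simp only [he', Finset.smul_sum, smul_smul, hZ, Matrix.mul_apply, Finset.sum_smul,
        Matrix.map_apply]
      rw [Finset.sum_comm]
    rw [this]
    exact sum_scalar_smul_mem_span _ _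
  refine ⟨e', fun i => ?_, fun φ hφ i => ?_⟩
  · rw [he', hDsum]
    refine hconst (X * a + X.map (delta τ)) (τ • Λ) (fun w => ?_) i
    have h1 : τ⁻¹ • (evalExp w).mapMatrix (X.map (delta τ)) = Λ * P w + P w * b w := by
      exact HasDerivAt.unique (hasDerivAt_mapMatrix_evalExp hτ X w)
        ((hP w).congr_of_eventuallyEq (Filter.Eventually.of_forall hX))
    have h2 : (evalExp w).mapMatrix (X.map (delta τ)) = τ • (Λ * P w + P w * b w) := by
      rw [← h1, smul_inv_smul₀ hτ]
    rw [map_add, map_mul, h2, hX]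
    simp [b, smul_add, smul_inv_smul₀ hτ]
  · let F : Matrix ι ι OCstar := Matrix.of fun i j => e.repr (φ (e i)) j
    have hFe : ∀ i, φ (e i) = ∑ j, F i j • e j := fun i => (e.sum_repr _).symm
    -- Commutation with the connection in coordinates; on the cover it reads F' = F b − b F.
    have h1 : a * F = F * a + F.map (delta τ) := by
      ext1 i k
      have h2 := hφ (e i)
      rw [hFe, hDsum, ha, map_sum] at h2
      simp only [map_smul, hFe, Finset.smul_sum, smul_smul] at h2
      rw [Finset.sum_comm] at h2
      simp only [← Finset.sum_smul] at h2
      have h3 := congrArg (fun m => e.repr m k) h2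
      simpa [Matrix.mul_apply, Finsupp.single_apply, Finset.sum_add_distrib] using h3
    have h2 := hF (fun w => (evalExp w).mapMatrix F) (mapMatrix_evalExp_periodic F) (fun w => by
      refine (hasDerivAt_mapMatrix_evalExp hτ F w).congr_deriv ?_
      rw [← add_sub_cancel_left (F * a) (F.map (delta τ)), ← h1, map_sub, map_mul, map_mul]
      simp [b, smul_sub]
      abel)
    have h3 : φ (e' i) = ∑ k, (X * F) i k • e k := by
      rw [he', map_sum]
      simp only [map_smul, hFe, Finset.smul_sum, smul_smul, Matrix.mul_apply, Finset.sum_smul]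
      rw [Finset.sum_comm]
    rw [h3]
    refine hconst (X * F) ((evalExp 0).mapMatrix F) (fun w => ?_) i
    rw [map_mul, hX, h2]

end ConstantBasis

/-! ### Freeness of kernels and cokernels of horizontal maps -/

section HorizontalMaps

open Module

variable {τ : ℂ} {ι ι' M N : Type*}
  [AddCommGroup M] [Module OCstar M] [AddCommGroup N] [Module OCstar N]

/-- A module over `𝒪(ℂ*)` as a complex vector space. -/
abbrev complexModule (M : Type*) [AddCommGroup M] [Module OCstar M] : Module ℂ M :=
  Module.compHom M (algebraMap ℂ OCstar)

theorem complexModule_isScalarTower (M : Type*) [AddCommGroup M] [Module OCstar M] :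
    letI := complexModule M
    IsScalarTower ℂ OCstar M :=
  letI := complexModule M
  ⟨fun c f m => by
    rw [Algebra.smul_def, mul_smul]
    rfl⟩

theorem prodMk_mem_span_basis_prod {ι k R L : Type*} [Field k] [CommRing R]
    [Algebra k R] [AddCommGroup L]
    [Module R L] [Module k L] [IsScalarTower k R L] (e : Basis ι R L) {x y : L}
    (hx : x ∈ Submodule.span k (Set.range e)) (hy : y ∈ Submodule.span k (Set.range e)) :
    (x, y) ∈ Submodule.span k (Set.range (e.prod e)) := by
  have h1 : Submodule.span k (Set.range e) ≤
      (Submodule.span k (Set.range (e.prod e))).comap (LinearMap.inl k L L) := by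
    rw [Submodule.span_le]
    rintro _ ⟨i, rfl⟩
    refine Submodule.subset_span ⟨Sum.inl i, ?_⟩
    simp
  have h2 : Submodule.span k (Set.range e) ≤
      (Submodule.span k (Set.range (e.prod e))).comap (LinearMap.inr k L L) := by
    rw [Submodule.span_le]
    rintro _ ⟨i, rfl⟩
    refine Submodule.subset_span ⟨Sum.inr i, ?_⟩
    simp
  have h3 : (x, y) = LinearMap.inl k L L x + LinearMap.inr k L L y := by simp
  rw [h3]
  exact add_mem (h1 hx) (h2 hy)

variable [Fintype ι] [Fintype ι']

/-- The graph setting: a horizontal map `f : M → N` and the projection to `M` become constant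
endomorphisms of `M × N` in a suitable basis. -/
theorem exists_constant_basis_prod [Module ℂ (M × N)] [IsScalarTower ℂ OCstar (M × N)]
    (hτ : τ ≠ 0) (eM : Basis ι OCstar M) (eN : Basis ι' OCstar N)
    {DM : M →+ M} (hDM : ∀ (f : OCstar) (m : M), DM (f • m) = f • DM m + delta τ f • m)
    {DN : N →+ N} (hDN : ∀ (f : OCstar) (m : N), DN (f • m) = f • DN m + delta τ f • m)
    (f : M →ₗ[OCstar] N) (hf : ∀ m, f (DM m) = DN (f m)) :
    ∃ e : Basis (ι ⊕ ι') OCstar (M × N),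
      (∀ i, ((e i).1, (0 : N)) ∈ Submodule.span ℂ (Set.range e)) ∧
      ∀ i, ((0 : M), f (e i).1) ∈ Submodule.span ℂ (Set.range e) := by
  classical
  have hD : ∀ (g : OCstar) (m : M × N), DM.prodMap DN (g • m) =
      g • DM.prodMap DN m + delta τ g • m := fun g m => Prod.ext (hDM g m.1) (hDN g m.2)
  obtain ⟨e, -, hφ⟩ := exists_constant_basis hτ (eM.prod eN) (DM.prodMap DN) hD
  refine ⟨e, fun i => ?_, fun i => ?_⟩
  · exact hφ (LinearMap.inl OCstar M N ∘ₗ LinearMap.fst OCstar M N) (fun m => by simp) i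
  · exact hφ (LinearMap.inr OCstar M N ∘ₗ f ∘ₗ LinearMap.fst OCstar M N) (fun m => by simp [hf]) i

/-- The kernel of a horizontal map of free modules with connection is free. -/
theorem exists_basis_ker_of_horizontal
    (hτ : τ ≠ 0) (eM : Basis ι OCstar M) (eN : Basis ι' OCstar N)
    {DM : M →+ M} (hDM : ∀ (f : OCstar) (m : M), DM (f • m) = f • DM m + delta τ f • m)
    {DN : N →+ N} (hDN : ∀ (f : OCstar) (m : N), DN (f • m) = f • DN m + delta τ f • m)
    (f : M →ₗ[OCstar] N) (hf : ∀ m, f (DM m) = DN (f m)) :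
    ∃ n : ℕ, Nonempty (Basis (Fin n) OCstar (LinearMap.ker f)) := by
  let := complexModule (M × N)
  have := complexModule_isScalarTower (M × N)
  obtain ⟨e, hp, hφ⟩ := exists_constant_basis_prod hτ eM eN hDM hDN f hf
  -- The kernel of (m, n) ↦ ((0, n), (0, f m)) is ker f × 0. The first component is the identity
  -- minus the projection to M, so `g` has constant matrix.
  let g : M × N →ₗ[OCstar] (M × N) × (M × N) :=
    (LinearMap.inr OCstar M N ∘ₗ LinearMap.snd OCstar M N).prod
      (LinearMap.inr OCstar M N ∘ₗ f ∘ₗ LinearMap.fst OCstar M N)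
  have hg : ∀ x, g x = ((0, x.2), (0, f x.1)) := fun x => rfl
  have hker : ∀ x, x ∈ LinearMap.ker g ↔ x.2 = 0 ∧ f x.1 = 0 := fun x => by
    rw [LinearMap.mem_ker, hg]
    simp [Prod.ext_iff]
  obtain ⟨n, ⟨B⟩⟩ := exists_basis_ker (k := ℂ) e (e.prod e) g fun i => by
    rw [hg]
    refine prodMk_mem_span_basis_prod e ?_ (hφ i)
    have := sub_mem (Submodule.subset_span ⟨i, rfl⟩ : e i ∈ Submodule.span ℂ (Set.range e)) (hp i)
    convert this using 1
    ext <;> simp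
  let E : LinearMap.ker g ≃ₗ[OCstar] LinearMap.ker f :=
    LinearEquiv.ofLinearMap
      (((LinearMap.fst OCstar M N) ∘ₗ (LinearMap.ker g).subtype).codRestrict _
        fun x => ((hker x).1 x.2).2)
      (((LinearMap.inl OCstar M N) ∘ₗ (LinearMap.ker f).subtype).codRestrict _
        fun x => (hker _).2 ⟨rfl, x.2⟩)
      (by ext x; rfl)
      (by
        ext1 x
        apply Subtype.ext
        exact Prod.ext rfl ((hker x).1 x.2).1.symm)
  exact ⟨n, ⟨B.map E⟩⟩

/-- The cokernel of a horizontal map of free modules with connection is free. -/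
theorem exists_basis_coker_of_horizontal
    (hτ : τ ≠ 0) (eM : Basis ι OCstar M) (eN : Basis ι' OCstar N)
    {DM : M →+ M} (hDM : ∀ (f : OCstar) (m : M), DM (f • m) = f • DM m + delta τ f • m)
    {DN : N →+ N} (hDN : ∀ (f : OCstar) (m : N), DN (f • m) = f • DN m + delta τ f • m)
    (f : M →ₗ[OCstar] N) (hf : ∀ m, f (DM m) = DN (f m)) :
    ∃ n : ℕ, Nonempty (Basis (Fin n) OCstar (N ⧸ LinearMap.range f)) := by
  let := complexModule (M × N)
  have := complexModule_isScalarTower (M × N)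
  obtain ⟨e, hp, hφ⟩ := exists_constant_basis_prod hτ eM eN hDM hDN f hf
  -- The range is M × range f, so the quotient of M × N by it is the cokernel of f.
  let g : (M × N) × (M × N) →ₗ[OCstar] M × N :=
    (LinearMap.inl OCstar M N ∘ₗ LinearMap.fst OCstar M N).coprod
      (LinearMap.inr OCstar M N ∘ₗ f ∘ₗ LinearMap.fst OCstar M N)
  have hg : ∀ x, g x = (x.1.1, f x.2.1) := fun x => by simp [g]
  obtain ⟨n, ⟨B⟩⟩ := exists_basis_coker (k := ℂ) (e.prod e) e g fun i => by
    rw [hg]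
    rcases i with i | i
    · simpa using hp i
    · simpa using hφ i
  let p : M × N →ₗ[OCstar] N ⧸ LinearMap.range f :=
    (LinearMap.range f).mkQ ∘ₗ LinearMap.snd OCstar M N
  have hpker : LinearMap.range g = LinearMap.ker p := by
    ext x
    rw [LinearMap.mem_ker]
    change _ ↔ Submodule.Quotient.mk x.2 = _
    rw [Submodule.Quotient.mk_eq_zero]
    constructor
    · rintro ⟨y, rfl⟩
      rw [hg]
      exact ⟨_, rfl⟩
    · rintro ⟨m, hm⟩
      exact ⟨((x.1, 0), (m, 0)), by rw [hg]; exact Prod.ext rfl hm⟩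
  have hps : Function.Surjective p := fun y => by
    obtain ⟨z, rfl⟩ := Submodule.Quotient.mk_surjective _ y
    exact ⟨(0, z), rfl⟩
  let E := (Submodule.quotEquivOfEq _ _ hpker).trans (p.quotKerEquivOfSurjective hps)
  exact ⟨n, ⟨B.map E⟩⟩

end HorizontalMaps

/-! ### Automatic regular singularity -/

section RegularSingular

open Module Topology

/-- A constant has order at least 0 at the origin (infinite order if it vanishes), and z⁻¹ has order
−1. Only a punctured neighbourhood matters, so the value of `extendZero` at 0 plays no role. -/
theorem atMostSimplePole_algebraMap (c : ℂ) : AtMostSimplePole (algebraMap ℂ OCstar c) := by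
  have h : (fun z : ℂ => z⁻¹ * extendZero (algebraMap ℂ OCstar c).1 z) =ᶠ[𝓝[≠] 0]
      ((fun z : ℂ => z)⁻¹ * fun _ => c) := by
    filter_upwards [self_mem_nhdsWithin] with z hz
    rw [extendZero_of_ne _ hz]
    rfl
  have h1 : MeromorphicAt (fun z : ℂ => z)⁻¹ 0 := MeromorphicAt.inv (MeromorphicAt.id 0)
  have h2 : AnalyticAt ℂ (fun _ : ℂ => c) 0 := analyticAt_const
  refine ⟨(h1.mul h2.meromorphicAt).congr h.symm, ?_⟩
  rw [meromorphicOrderAt_congr h, meromorphicOrderAt_mul h1 h2.meromorphicAt,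
    meromorphicOrderAt_inv]
  have h3 : meromorphicOrderAt (fun z : ℂ => z) 0 = 1 := meromorphicOrderAt_id
  rw [h3]
  exact le_add_of_nonneg_right h2.meromorphicOrderAt_nonneg

variable {θ : ℝ} {τ : ℂ}

/-- Every connection on a free module of finite rank is regular singular. -/
theorem Connection.isRegularSingular_of_basis {κ : Type*} [Finite κ] (hτ : τ ≠ 0) {M : Bq.{w} θ}
    (e : Basis κ OCstar M) (D : Connection τ M) : D.IsRegularSingular := by
  classical
  let := complexModule M
  have := complexModule_isScalarTower M
  obtain ⟨n, ⟨eqv⟩⟩ := Finite.exists_equiv_fin κ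
  obtain ⟨b, hb, -⟩ := exists_constant_basis hτ (e.reindex eqv) D.nabla D.leibniz
  refine ⟨n, b, fun i j => ?_⟩
  obtain ⟨c, hc⟩ := (Submodule.mem_span_range_iff_exists_fun ℂ).1 (hb i)
  have h : b.repr (D.nabla (b i)) j = algebraMap ℂ OCstar (c j) := by
    have h' : D.nabla (b i) = ∑ k, algebraMap ℂ OCstar (c k) • b k := by
      rw [← hc]
      exact Finset.sum_congr rfl fun k _ => (algebraMap_smul OCstar (c k) (b k)).symm
    rw [h', Module.Basis.repr_sum_self]
  rw [h]
  exact atMostSimplePole_algebraMap _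

theorem Connection.IsRegularSingular.exists_basis {M : Bq.{w} θ} {D : Connection τ M}
    (hD : D.IsRegularSingular) : ∃ n : ℕ, Nonempty (Basis (Fin n) OCstar M) :=
  let ⟨n, e, _⟩ := hD
  ⟨n, ⟨e⟩⟩

theorem finitePresentation_of_basis {R L κ : Type*} [CommRing R] [AddCommGroup L] [Module R L]
    [Finite κ] (e : Basis κ R L) : Module.FinitePresentation R L :=
  have := Module.Free.of_basis e
  have := Module.Finite.of_basis e
  Module.finitePresentation_of_projective R L

end RegularSingular

/-! ### Kernels, cokernels and sums of equivariant modules -/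

namespace Bq

variable {θ : ℝ} {M N : Bq.{w} θ}

theorem mem_ker_iff (f : M ⟶ N) (m : M) :
    m ∈ LinearMap.ker f.lin ↔ M.σ m ∈ LinearMap.ker f.lin := by
  simp [LinearMap.mem_ker, f.equivariant]

/-- The kernel of a morphism of `ℬ_q`, when it is finitely presented. -/
def kernelObj (f : M ⟶ N) (h : Module.FinitePresentation OCstar (LinearMap.ker f.lin)) :
    Bq.{w} θ where
  carrier := LinearMap.ker f.lin
  finitePresentation := h
  σ :=
    { toFun := fun x => ⟨M.σ x, (mem_ker_iff f x).1 x.2⟩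
      invFun := fun x => ⟨M.σ.symm x, (mem_ker_iff f _).2 (by simp)⟩
      left_inv := fun x => Subtype.ext (by simp)
      right_inv := fun x => Subtype.ext (by simp)
      map_add' := fun x y => Subtype.ext (by simp) }
  σ_smul g x := Subtype.ext (M.σ_smul g x)

/-- The inclusion of the kernel. -/
def kernelMap (f : M ⟶ N) (h : Module.FinitePresentation OCstar (LinearMap.ker f.lin)) :
    kernelObj f h ⟶ M :=
  Hom.mk (LinearMap.ker f.lin).subtype fun _ => rfl

/-- The cokernel of a morphism of `ℬ_q`, when it is finitely presented. -/
def cokernelObj (f : M ⟶ N) (h : Module.FinitePresentation OCstar (N ⧸ LinearMap.range f.lin)) :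
    Bq.{w} θ where
  carrier := N ⧸ LinearMap.range f.lin
  finitePresentation := h
  σ := QuotientAddGroup.congr (LinearMap.range f.lin).toAddSubgroup
    (LinearMap.range f.lin).toAddSubgroup N.σ (by
      ext y
      constructor
      · rintro ⟨_, ⟨m, rfl⟩, rfl⟩
        exact ⟨M.σ m, f.equivariant m⟩
      · rintro ⟨m, rfl⟩
        refine ⟨f.lin (M.σ.symm m), ⟨_, rfl⟩, ?_⟩
        change N.σ (f.lin (M.σ.symm m)) = _
        rw [← f.equivariant, AddEquiv.apply_symm_apply])
  σ_smul g x := by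
    obtain ⟨y, rfl⟩ := Submodule.Quotient.mk_surjective _ x
    exact congrArg (Submodule.Quotient.mk (p := LinearMap.range f.lin)) (N.σ_smul g y)

/-- The projection to the cokernel. -/
def cokernelMap (f : M ⟶ N)
    (h : Module.FinitePresentation OCstar (N ⧸ LinearMap.range f.lin)) :
    N ⟶ cokernelObj f h :=
  Hom.mk (LinearMap.range f.lin).mkQ fun _ => rfl

variable {K C : Bq.{w} θ}

/-- Factorization through an injective morphism. -/
theorem exists_lift {ι : K ⟶ M} (hinj : Function.Injective ι.lin) {W : Bq.{w} θ} (g : W ⟶ M)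
    (hg : ∀ x, g.lin x ∈ LinearMap.range ι.lin) : ∃ l : W ⟶ K, l ≫ ι = g := by
  let l : W →ₗ[OCstar] K :=
    (LinearEquiv.ofInjective ι.lin hinj).symm.toLinearMap ∘ₗ g.lin.codRestrict _ hg
  have hl : ∀ x, ι.lin (l x) = g.lin x := fun x =>
    congrArg Subtype.val ((LinearEquiv.ofInjective ι.lin hinj).apply_symm_apply ⟨g.lin x, hg x⟩)
  refine ⟨Hom.mk l fun x => hinj ?_, hom_ext (LinearMap.ext hl)⟩
  rw [hl, g.equivariant, ι.equivariant, hl]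

/-- Factorization through a surjective morphism. -/
theorem exists_desc {π : N ⟶ C} (hsurj : Function.Surjective π.lin) {W : Bq.{w} θ} (g : N ⟶ W)
    (hg : ∀ x, π.lin x = 0 → g.lin x = 0) : ∃ l : C ⟶ W, π ≫ l = g := by
  let l : C →ₗ[OCstar] W :=
    ((LinearMap.ker π.lin).liftQ g.lin fun x hx => hg x hx) ∘ₗ
      (π.lin.quotKerEquivOfSurjective hsurj).symm.toLinearMap
  have hl : ∀ x, l (π.lin x) = g.lin x := fun x => by
    have : (π.lin.quotKerEquivOfSurjective hsurj).symm (π.lin x) = Submodule.Quotient.mk x := by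
      rw [LinearEquiv.symm_apply_eq]
      rfl
    simp only [l, LinearMap.comp_apply, LinearEquiv.coe_coe, this]
    rfl
  refine ⟨Hom.mk l fun x => ?_, hom_ext (LinearMap.ext hl)⟩
  obtain ⟨y, rfl⟩ := hsurj x
  rw [← π.equivariant, hl, hl, g.equivariant]

theorem comp_eq_zero_iff {f : M ⟶ N} {g : N ⟶ C} :
    f ≫ g = 0 ↔ ∀ x, g.lin (f.lin x) = 0 :=
  ⟨fun h x => LinearMap.congr_fun (congrArg Hom.lin h) x, fun h => hom_ext (LinearMap.ext h)⟩

theorem lin_hom_inv {M N : Bq.{w} θ} (e : M ≅ N) (x : M) : e.inv.lin (e.hom.lin x) = x :=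
  LinearMap.congr_fun (congrArg Hom.lin e.hom_inv_id) x

theorem lin_inv_hom {M N : Bq.{w} θ} (e : M ≅ N) (x : N) : e.hom.lin (e.inv.lin x) = x :=
  LinearMap.congr_fun (congrArg Hom.lin e.inv_hom_id) x

/-- The linear equivalence underlying an isomorphism of `ℬ_q`. -/
def linearEquivOfIso {M N : Bq.{w} θ} (e : M ≅ N) : M ≃ₗ[OCstar] N :=
  { e.hom.lin with
    invFun := e.inv.lin
    left_inv := lin_hom_inv e
    right_inv := lin_inv_hom e }

/-- Exactness on underlying modules suffices: the linear factorization through an injective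
equivariant map is itself equivariant. -/
theorem isLimit_of_exact {f : M ⟶ N} {ι : K ⟶ M} (hι : ι ≫ f = 0)
    (hinj : Function.Injective ι.lin) (hex : LinearMap.ker f.lin ≤ LinearMap.range ι.lin) :
    Nonempty (IsLimit (KernelFork.ofι ι hι)) := by
  have h : ∀ {W : Bq.{w} θ} (g : W ⟶ M), g ≫ f = 0 → ∃ l : W ⟶ K, l ≫ ι = g :=
    fun g hg => exists_lift hinj g fun x => hex (comp_eq_zero_iff.1 hg x)
  refine ⟨KernelFork.IsLimit.ofι ι hι (fun g hg => (h g hg).choose)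
    (fun g hg => (h g hg).choose_spec) fun g hg m hm => ?_⟩
  apply hom_ext
  ext x
  apply hinj
  exact LinearMap.congr_fun (congrArg Hom.lin (hm.trans (h g hg).choose_spec.symm)) x

theorem isColimit_of_exact {f : M ⟶ N} {π : N ⟶ C} (hπ : f ≫ π = 0)
    (hsurj : Function.Surjective π.lin) (hex : LinearMap.ker π.lin ≤ LinearMap.range f.lin) :
    Nonempty (IsColimit (CokernelCofork.ofπ π hπ)) := by
  have h : ∀ {W : Bq.{w} θ} (g : N ⟶ W), f ≫ g = 0 → ∃ l : C ⟶ W, π ≫ l = g :=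
    fun g hg => exists_desc hsurj g fun x hx => by
      obtain ⟨y, rfl⟩ := hex hx
      exact comp_eq_zero_iff.1 hg y
  refine ⟨CokernelCofork.IsColimit.ofπ π hπ (fun g hg => (h g hg).choose)
    (fun g hg => (h g hg).choose_spec) fun g hg m hm => ?_⟩
  apply hom_ext
  ext x
  obtain ⟨y, rfl⟩ := hsurj x
  exact LinearMap.congr_fun (congrArg Hom.lin (hm.trans (h g hg).choose_spec.symm)) y

theorem kernelMap_comp (f : M ⟶ N) (h : Module.FinitePresentation OCstar (LinearMap.ker f.lin)) :
    kernelMap f h ≫ f = 0 :=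
  comp_eq_zero_iff.2 fun x => x.2

theorem isLimit_kernelMap (f : M ⟶ N)
    (h : Module.FinitePresentation OCstar (LinearMap.ker f.lin)) :
    Nonempty (IsLimit (KernelFork.ofι (kernelMap f h) (kernelMap_comp f h))) :=
  isLimit_of_exact _ Subtype.val_injective fun x hx => ⟨⟨x, hx⟩, rfl⟩

theorem comp_cokernelMap (f : M ⟶ N)
    (h : Module.FinitePresentation OCstar (N ⧸ LinearMap.range f.lin)) :
    f ≫ cokernelMap f h = 0 :=
  comp_eq_zero_iff.2 fun _ => (Submodule.Quotient.mk_eq_zero _).2 ⟨_, rfl⟩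

theorem isColimit_cokernelMap (f : M ⟶ N)
    (h : Module.FinitePresentation OCstar (N ⧸ LinearMap.range f.lin)) :
    Nonempty (IsColimit (CokernelCofork.ofπ (cokernelMap f h) (comp_cokernelMap f h))) :=
  isColimit_of_exact _ (Submodule.Quotient.mk_surjective _) fun _ hx =>
    (Submodule.Quotient.mk_eq_zero _).1 hx

/-- The direct sum in `ℬ_q`. -/
def prod (M N : Bq.{w} θ) : Bq.{w} θ where
  carrier := M × N
  finitePresentation :=
    have := M.finitePresentation
    have := N.finitePresentation
    inferInstance
  σ := AddEquiv.prodCongr M.σ N.σ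
  σ_smul g x := Prod.ext (M.σ_smul g x.1) (N.σ_smul g x.2)

/-- The zero object of `ℬ_q`. -/
def zero (θ : ℝ) : Bq.{w} θ where
  carrier := PUnit.{w + 1}
  finitePresentation :=
    finitePresentation_of_basis (R := OCstar) (Module.Basis.empty (ι := Fin 0) PUnit.{w + 1})
  σ := AddEquiv.refl _
  σ_smul _ _ := rfl

end Bq

/-! ### Transported and induced connections -/

namespace Connection

variable {θ : ℝ} {τ : ℂ} {M N K C : Bq.{w} θ}

/-- Transport of a connection along an isomorphism. -/
def ofIso (e : K ≅ M) (D : Connection τ M) : Connection τ K where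
  nabla := e.inv.lin.toAddMonoidHom.comp (D.nabla.comp e.hom.lin.toAddMonoidHom)
  leibniz f m := by
    change e.inv.lin (D.nabla (e.hom.lin (f • m))) = f • e.inv.lin (D.nabla (e.hom.lin m)) + _
    rw [map_smul, D.leibniz, map_add, map_smul, map_smul, Bq.lin_hom_inv]
  equivariant m := by
    change e.inv.lin (D.nabla (e.hom.lin (K.σ m))) = K.σ (e.inv.lin (D.nabla (e.hom.lin m)))
    rw [e.hom.equivariant, D.equivariant, e.inv.equivariant]

theorem ofIso_nabla (e : K ≅ M) (D : Connection τ M) (m : K) :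
    (D.ofIso e).nabla m = e.inv.lin (D.nabla (e.hom.lin m)) := rfl

/-- The connection induced on the kernel. -/
def kernel (D : Connection τ M) (E : Connection τ N) {f : M ⟶ N} (hf : Compatible D E f)
    (h : Module.FinitePresentation OCstar (LinearMap.ker f.lin)) :
    Connection τ (Bq.kernelObj f h) where
  nabla :=
    { toFun := fun x => ⟨D.nabla x.1, by rw [LinearMap.mem_ker, hf, x.2, map_zero]⟩
      map_zero' := Subtype.ext (map_zero D.nabla)
      map_add' := fun x y => Subtype.ext (map_add D.nabla x.1 y.1) }
  leibniz g x := Subtype.ext (D.leibniz g x.1)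
  equivariant x := Subtype.ext (D.equivariant x.1)

/-- The connection induced on the cokernel. -/
def cokernel (D : Connection τ M) (E : Connection τ N) {f : M ⟶ N} (hf : Compatible D E f)
    (h : Module.FinitePresentation OCstar (N ⧸ LinearMap.range f.lin)) :
    Connection τ (Bq.cokernelObj f h) where
  nabla := QuotientAddGroup.map (LinearMap.range f.lin).toAddSubgroup
    (LinearMap.range f.lin).toAddSubgroup E.nabla (by
      rintro _ ⟨m, rfl⟩
      exact ⟨D.nabla m, hf m⟩)
  leibniz g x := by
    obtain ⟨y, rfl⟩ := Submodule.Quotient.mk_surjective _ x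
    exact congrArg (Submodule.Quotient.mk (p := LinearMap.range f.lin)) (E.leibniz g y)
  equivariant x := by
    obtain ⟨y, rfl⟩ := Submodule.Quotient.mk_surjective _ x
    exact congrArg (Submodule.Quotient.mk (p := LinearMap.range f.lin)) (E.equivariant y)

theorem compatible_cokernelMap (D : Connection τ M) (E : Connection τ N) {f : M ⟶ N}
    (hf : Compatible D E f)
    (h : Module.FinitePresentation OCstar (N ⧸ LinearMap.range f.lin)) :
    Compatible E (D.cokernel E hf h) (Bq.cokernelMap f h) := fun _ => rfl

/-- The direct sum of connections. -/
def prod (D : Connection τ M)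
    (E : Connection τ N) : Connection τ (M.prod N) where
  nabla := D.nabla.prodMap E.nabla
  leibniz g x := Prod.ext (D.leibniz g x.1) (E.leibniz g x.2)
  equivariant x := Prod.ext (D.equivariant x.1) (E.equivariant x.2)

end Connection

/-! ### Kernels and cokernels with connection -/

namespace BqTau

open Module

variable {θ : ℝ} {τ : ℂ} {K C M N : BqTau.{w} θ τ}

/-- The underlying linear map of a morphism. -/
abbrev lin (f : M ⟶ N) : M.toBq →ₗ[OCstar] N.toBq := f.toBq.lin

theorem comp_eq_zero_iff {f : M ⟶ N} {g : N ⟶ C} :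
    f ≫ g = 0 ↔ ∀ x, lin g (lin f x) = 0 :=
  ⟨fun h => Bq.comp_eq_zero_iff.1 (congrArg Hom.toBq h), fun h =>
    hom_ext (Bq.comp_eq_zero_iff.2 h)⟩

theorem exists_basis_ker (hτ : τ ≠ 0) (f : M ⟶ N) :
    ∃ n : ℕ, Nonempty (Basis (Fin n) OCstar (LinearMap.ker (lin f))) := by
  obtain ⟨_, ⟨eM⟩⟩ := M.regularSingular.exists_basis
  obtain ⟨_, ⟨eN⟩⟩ := N.regularSingular.exists_basis
  exact exists_basis_ker_of_horizontal hτ eM eN M.conn.leibniz N.conn.leibniz (lin f) f.compatible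

theorem exists_basis_coker (hτ : τ ≠ 0) (f : M ⟶ N) :
    ∃ n : ℕ, Nonempty (Basis (Fin n) OCstar (N.toBq ⧸ LinearMap.range (lin f))) := by
  obtain ⟨_, ⟨eM⟩⟩ := M.regularSingular.exists_basis
  obtain ⟨_, ⟨eN⟩⟩ := N.regularSingular.exists_basis
  exact exists_basis_coker_of_horizontal hτ eM eN M.conn.leibniz N.conn.leibniz (lin f)
    f.compatible

theorem finitePresentation_ker (hτ : τ ≠ 0) (f : M ⟶ N) :
    Module.FinitePresentation OCstar (LinearMap.ker (lin f)) :=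
  let ⟨_, ⟨b⟩⟩ := exists_basis_ker hτ f
  finitePresentation_of_basis (R := OCstar) (L := LinearMap.ker (lin f)) b

theorem finitePresentation_coker (hτ : τ ≠ 0) (f : M ⟶ N) :
    Module.FinitePresentation OCstar (N.toBq ⧸ LinearMap.range (lin f)) :=
  let ⟨_, ⟨b⟩⟩ := exists_basis_coker hτ f
  finitePresentation_of_basis b

/-- The factorization found in ℬ_q respects the connections, because this can be tested after the
injective map `ι`. -/
theorem isLimit_of_exact {f : M ⟶ N} {ι : K ⟶ M} (hι : ι ≫ f = 0)
    (hinj : Function.Injective (lin ι)) (hex : LinearMap.ker (lin f) ≤ LinearMap.range (lin ι)) :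
    Nonempty (IsLimit (KernelFork.ofι ι hι)) := by
  have h : ∀ {W : BqTau.{w} θ τ} (g : W ⟶ M), g ≫ f = 0 → ∃ l : W ⟶ K, l ≫ ι = g := by
    intro W g hg
    obtain ⟨l, hl⟩ := Bq.exists_lift hinj g.toBq fun x => hex (comp_eq_zero_iff.1 hg x)
    have hl' : ∀ x, lin ι (l.lin x) = lin g x := fun x =>
      LinearMap.congr_fun (congrArg Bq.Hom.lin hl) x
    refine ⟨homMk l fun x => hinj ?_, hom_ext hl⟩
    rw [hl', g.compatible, ι.compatible, hl']
  refine ⟨KernelFork.IsLimit.ofι ι hι (fun g hg => (h g hg).choose)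
    (fun g hg => (h g hg).choose_spec) fun g hg m hm => ?_⟩
  apply hom_ext
  apply Bq.hom_ext
  ext x
  apply hinj
  exact LinearMap.congr_fun (congrArg lin (hm.trans (h g hg).choose_spec.symm)) x

theorem isColimit_of_exact {f : M ⟶ N} {π : N ⟶ C} (hπ : f ≫ π = 0)
    (hsurj : Function.Surjective (lin π))
    (hex : LinearMap.ker (lin π) ≤ LinearMap.range (lin f)) :
    Nonempty (IsColimit (CokernelCofork.ofπ π hπ)) := by
  have h : ∀ {W : BqTau.{w} θ τ} (g : N ⟶ W), f ≫ g = 0 → ∃ l : C ⟶ W, π ≫ l = g := by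
    intro W g hg
    obtain ⟨l, hl⟩ := Bq.exists_desc hsurj g.toBq fun x hx => by
      obtain ⟨y, rfl⟩ := hex hx
      exact comp_eq_zero_iff.1 hg y
    have hl' : ∀ x, l.lin (lin π x) = lin g x := fun x =>
      LinearMap.congr_fun (congrArg Bq.Hom.lin hl) x
    refine ⟨homMk l fun x => ?_, hom_ext hl⟩
    obtain ⟨y, rfl⟩ := hsurj x
    rw [← π.compatible, hl', hl', g.compatible]
  refine ⟨CokernelCofork.IsColimit.ofπ π hπ (fun g hg => (h g hg).choose)
    (fun g hg => (h g hg).choose_spec) fun g hg m hm => ?_⟩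
  apply hom_ext
  apply Bq.hom_ext
  ext x
  obtain ⟨y, rfl⟩ := hsurj x
  exact LinearMap.congr_fun (congrArg lin (hm.trans (h g hg).choose_spec.symm)) y

theorem hasKernel_forget_map (hτ : τ ≠ 0) (f : M ⟶ N) :
    HasKernel ((BqTau.forget θ τ).map f) :=
  let ⟨h⟩ := Bq.isLimit_kernelMap f.toBq (finitePresentation_ker hτ f)
  HasLimit.mk ⟨_, h⟩

theorem hasCokernel_forget_map (hτ : τ ≠ 0) (f : M ⟶ N) :
    HasCokernel ((BqTau.forget θ τ).map f) :=
  let ⟨h⟩ := Bq.isColimit_cokernelMap f.toBq (finitePresentation_coker hτ f)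
  HasColimit.mk ⟨_, h⟩

/-- A kernel in `ℬ_q` of a morphism of `ℬ_q^τ` carries a unique compatible connection, and is
then a kernel in `ℬ_q^τ`. -/
theorem exists_connection_of_isLimit (hτ : τ ≠ 0) (f : M ⟶ N) (K : Bq.{w} θ) (ι : K ⟶ M.toBq)
    (hι : ι ≫ f.toBq = 0) (hlim : Nonempty (IsLimit (KernelFork.ofι ι hι))) :
    ∃ (D : Connection τ K) (hD : D.IsRegularSingular) (hc : Compatible D M.conn ι),
      (∀ D' : Connection τ K, Compatible D' M.conn ι → D' = D) ∧
      ∃ h : (BqTau.homMk ι hc : BqTau.mk K D hD ⟶ M) ≫ f = 0,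
        Nonempty (IsLimit
          (KernelFork.ofι (BqTau.homMk ι hc : BqTau.mk K D hD ⟶ M) h)) := by
  obtain ⟨hlim⟩ := hlim
  have hfp := finitePresentation_ker hτ f
  obtain ⟨hlim'⟩ := Bq.isLimit_kernelMap f.toBq hfp
  -- An arbitrary kernel is compared with the module-theoretic one, which supplies injectivity,
  -- exactness and the connection.
  let e : K ≅ Bq.kernelObj f.toBq hfp := hlim.conePointUniqueUpToIso hlim'
  have he : e.hom ≫ Bq.kernelMap f.toBq hfp = ι :=
    hlim.conePointUniqueUpToIso_hom_comp hlim' WalkingParallelPair.zero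
  have heι : ∀ x, (Bq.kernelMap f.toBq hfp).lin (e.hom.lin x) = ι.lin x := fun x =>
    LinearMap.congr_fun (congrArg Bq.Hom.lin he) x
  have hinj : Function.Injective ι.lin := by
    intro x y hxy
    rw [← heι, ← heι] at hxy
    exact (Bq.linearEquivOfIso e).injective (Subtype.val_injective hxy)
  have hex : LinearMap.ker f.toBq.lin ≤ LinearMap.range ι.lin := by
    intro x hx
    let y : Bq.kernelObj f.toBq hfp := (⟨x, hx⟩ : LinearMap.ker f.toBq.lin)
    refine ⟨e.inv.lin y, ?_⟩
    rw [← heι, Bq.lin_inv_hom]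
    rfl
  let D := (M.conn.kernel N.conn f.compatible hfp).ofIso e
  have hc : Compatible D M.conn ι := by
    intro m
    rw [Connection.ofIso_nabla, ← heι, ← heι, Bq.lin_inv_hom]
    rfl
  obtain ⟨_, ⟨b⟩⟩ := exists_basis_ker hτ f
  refine ⟨D, D.isRegularSingular_of_basis hτ (b.map (Bq.linearEquivOfIso e).symm), hc,
    fun D' hD' => ?_, hom_ext hι, isLimit_of_exact _ hinj hex⟩
  apply Connection.ext
  ext x
  apply hinj
  rw [hD', hc]

/-- A cokernel in `ℬ_q` of a morphism of `ℬ_q^τ` carries a unique compatible connection, and is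
then a cokernel in `ℬ_q^τ`. -/
theorem exists_connection_of_isColimit (hτ : τ ≠ 0) (f : M ⟶ N) (C : Bq.{w} θ)
    (π : N.toBq ⟶ C) (hπ : f.toBq ≫ π = 0)
    (hcolim : Nonempty (IsColimit (CokernelCofork.ofπ π hπ))) :
    ∃ (D : Connection τ C) (hD : D.IsRegularSingular) (hc : Compatible N.conn D π),
      (∀ D' : Connection τ C, Compatible N.conn D' π → D' = D) ∧
      ∃ h : f ≫ (BqTau.homMk π hc : N ⟶ BqTau.mk C D hD) = 0,
        Nonempty (IsColimit
          (CokernelCofork.ofπ (BqTau.homMk π hc : N ⟶ BqTau.mk C D hD) h)) := by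
  obtain ⟨hcolim⟩ := hcolim
  have hfp := finitePresentation_coker hτ f
  obtain ⟨hcolim'⟩ := Bq.isColimit_cokernelMap f.toBq hfp
  let e : C ≅ Bq.cokernelObj f.toBq hfp := hcolim.coconePointUniqueUpToIso hcolim'
  have he : π ≫ e.hom = Bq.cokernelMap f.toBq hfp :=
    hcolim.comp_coconePointUniqueUpToIso_hom hcolim' WalkingParallelPair.one
  have heπ : ∀ x, e.hom.lin (π.lin x) = (Bq.cokernelMap f.toBq hfp).lin x := fun x =>
    LinearMap.congr_fun (congrArg Bq.Hom.lin he) x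
  have hsurj : Function.Surjective π.lin := by
    intro x
    obtain ⟨y, hy⟩ := Submodule.Quotient.mk_surjective (LinearMap.range f.toBq.lin) (e.hom.lin x)
    refine ⟨y, (Bq.linearEquivOfIso e).injective ?_⟩
    exact (heπ y).trans hy
  have hex : LinearMap.ker π.lin ≤ LinearMap.range f.toBq.lin := by
    intro x hx
    have := heπ x
    rw [LinearMap.mem_ker.1 hx, map_zero] at this
    exact (Submodule.Quotient.mk_eq_zero _).1 this.symm
  let D := (M.conn.cokernel N.conn f.compatible hfp).ofIso e
  -- The quotient connection is transported back along `e`, under which `π` corresponds to the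
  -- quotient map.
  have hc : Compatible N.conn D π := by
    intro m
    rw [Connection.ofIso_nabla, heπ]
    have h := M.conn.compatible_cokernelMap N.conn f.compatible hfp m
    rw [← h, ← heπ, Bq.lin_hom_inv]
  obtain ⟨_, ⟨b⟩⟩ := exists_basis_coker hτ f
  refine ⟨D, D.isRegularSingular_of_basis hτ (b.map (Bq.linearEquivOfIso e).symm), hc,
    fun D' hD' => ?_, hom_ext hπ, isColimit_of_exact _ hsurj hex⟩
  apply Connection.ext
  ext x
  obtain ⟨y, rfl⟩ := hsurj x
  rw [← hD', ← hc]

theorem exists_kernel (hτ : τ ≠ 0) (f : M ⟶ N) :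
    ∃ (K : BqTau.{w} θ τ) (ι : K ⟶ M) (h : ι ≫ f = 0),
      LinearMap.range (lin ι) = LinearMap.ker (lin f) ∧
        Nonempty (IsLimit (KernelFork.ofι ι h)) := by
  have hfp := finitePresentation_ker hτ f
  obtain ⟨D, hD, hc, -, h, hl⟩ := exists_connection_of_isLimit hτ f _ _
    (Bq.kernelMap_comp f.toBq hfp) (Bq.isLimit_kernelMap f.toBq hfp)
  exact ⟨_, _, h, Submodule.range_subtype _, hl⟩

theorem exists_cokernel (hτ : τ ≠ 0) (f : M ⟶ N) :
    ∃ (C : BqTau.{w} θ τ) (π : N ⟶ C) (h : f ≫ π = 0),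
      LinearMap.ker (lin π) = LinearMap.range (lin f) ∧
        Nonempty (IsColimit (CokernelCofork.ofπ π h)) := by
  have hfp := finitePresentation_coker hτ f
  obtain ⟨D, hD, hc, -, h, hl⟩ := exists_connection_of_isColimit hτ f _ _
    (Bq.comp_cokernelMap f.toBq hfp) (Bq.isColimit_cokernelMap f.toBq hfp)
  exact ⟨_, _, h, Submodule.ker_mkQ _, hl⟩

/-! ### The abelian structure -/

theorem hasKernels (hτ : τ ≠ 0) : HasKernels (BqTau.{w} θ τ) where
  has_limit f :=
    let ⟨_, _, _, _, ⟨h⟩⟩ := exists_kernel hτ f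
    HasLimit.mk ⟨_, h⟩

theorem hasCokernels (hτ : τ ≠ 0) : HasCokernels (BqTau.{w} θ τ) where
  has_colimit f :=
    let ⟨_, _, _, _, ⟨h⟩⟩ := exists_cokernel hτ f
    HasColimit.mk ⟨_, h⟩

/-- The kernel of a monomorphism vanishes, and kernels are computed on modules, so the map is
injective. Its range is the kernel of its cokernel map, so it is a kernel of that map. -/
theorem isNormalMonoCategory (hτ : τ ≠ 0) : IsNormalMonoCategory (BqTau.{w} θ τ) where
  normalMonoOfMono f _ := by
    obtain ⟨K, ι, hι, hr, -⟩ := exists_kernel hτ f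
    obtain ⟨C, π, hπ, hk, -⟩ := exists_cokernel hτ f
    have hι0 : ι = 0 := by rwa [← cancel_mono f, zero_comp]
    have hinj : Function.Injective (lin f) := by
      rw [← LinearMap.ker_eq_bot, ← hr, hι0]
      exact LinearMap.range_zero
    exact ⟨⟨C, π, hπ, (isLimit_of_exact hπ hinj hk.le).some⟩⟩

/-- Dually, a vanishing cokernel forces surjectivity, and a surjection is the cokernel of its
kernel. -/
theorem isNormalEpiCategory (hτ : τ ≠ 0) : IsNormalEpiCategory (BqTau.{w} θ τ) where
  normalEpiOfEpi f _ := by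
    obtain ⟨K, ι, hι, hr, -⟩ := exists_kernel hτ f
    obtain ⟨C, π, hπ, hk, -⟩ := exists_cokernel hτ f
    have hπ0 : π = 0 := by rwa [← cancel_epi f, comp_zero]
    have hsurj : Function.Surjective (lin f) := by
      rw [← LinearMap.range_eq_top, ← hk, hπ0]
      exact LinearMap.ker_zero
    exact ⟨⟨K, ι, hι, (isColimit_of_exact hι hsurj hr.ge).some⟩⟩

theorem isRegularSingular_prod (hτ : τ ≠ 0) (M N : BqTau.{w} θ τ) :
    (M.conn.prod N.conn).IsRegularSingular := by
  obtain ⟨_, ⟨eM⟩⟩ := M.regularSingular.exists_basis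
  obtain ⟨_, ⟨eN⟩⟩ := N.regularSingular.exists_basis
  exact Connection.isRegularSingular_of_basis hτ (eM.prod eN) _

theorem hasBinaryBiproducts (hτ : τ ≠ 0) : HasBinaryBiproducts (BqTau.{w} θ τ) where
  has_binary_biproduct M N := by
    let P : BqTau.{w} θ τ := ⟨M.toBq.prod N.toBq, _, isRegularSingular_prod hτ M N⟩
    let p₁ : P ⟶ M := ⟨⟨LinearMap.fst OCstar M.toBq N.toBq, fun _ => rfl⟩, fun _ => rfl⟩
    let p₂ : P ⟶ N := ⟨⟨LinearMap.snd OCstar M.toBq N.toBq, fun _ => rfl⟩, fun _ => rfl⟩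
    let i₁ : M ⟶ P := ⟨⟨LinearMap.inl OCstar M.toBq N.toBq, fun _ =>
      Prod.ext rfl (map_zero N.toBq.σ).symm⟩, fun _ => Prod.ext rfl (map_zero N.conn.nabla).symm⟩
    let i₂ : N ⟶ P := ⟨⟨LinearMap.inr OCstar M.toBq N.toBq, fun _ =>
      Prod.ext (map_zero M.toBq.σ).symm rfl⟩, fun _ => Prod.ext (map_zero M.conn.nabla).symm rfl⟩
    refine hasBinaryBiproduct_of_total
      { pt := P, fst := p₁, snd := p₂, inl := i₁, inr := i₂
        inl_fst := rfl, inl_snd := rfl, inr_fst := rfl, inr_snd := rfl } ?_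
    apply hom_ext
    apply Bq.hom_ext
    exact LinearMap.ext fun x => Prod.ext (add_zero x.1) (zero_add x.2)

theorem hasZeroObject (hτ : τ ≠ 0) : HasZeroObject (BqTau.{w} θ τ) := by
  let D : Connection τ (Bq.zero.{w} θ) :=
    ⟨0, fun _ _ => rfl, fun _ => Subsingleton.elim (α := PUnit) _ _⟩
  let Z : BqTau.{w} θ τ := ⟨Bq.zero θ, D,
    D.isRegularSingular_of_basis hτ (Basis.empty (ι := Fin 0) PUnit.{w + 1})⟩
  refine ⟨Z, (IsZero.iff_id_eq_zero Z).2 ?_⟩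
  apply hom_ext
  apply Bq.hom_ext
  rfl

theorem hasFiniteProducts (hτ : τ ≠ 0) : HasFiniteProducts (BqTau.{w} θ τ) :=
  have := hasBinaryBiproducts.{w} (θ := θ) hτ
  have := hasZeroObject.{w} (θ := θ) hτ
  hasFiniteProducts_of_has_binary_and_terminal

end BqTau

end NCEllipticCurve

theorem proposition6 (θ : ℝ) (hθ : Irrational θ) (τ : ℂ) (hτ : τ.im < 0) :
    (∃ A : Abelian (BqTau.{w} θ τ),
      A.toPreadditive = (inferInstance : Preadditive (BqTau.{w} θ τ))) ∧
    ∀ (M N : BqTau.{w} θ τ) (f : M ⟶ N),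
      (HasKernel ((BqTau.forget θ τ).map f) ∧
        ∀ (K : Bq.{w} θ) (ι : K ⟶ M.toBq) (hι : ι ≫ (BqTau.forget θ τ).map f = 0),
          Nonempty (IsLimit (KernelFork.ofι ι hι)) →
          ∃ (D : Connection τ K) (hD : D.IsRegularSingular) (hc : Compatible D M.conn ι),
            (∀ D' : Connection τ K, Compatible D' M.conn ι → D' = D) ∧
            ∃ h : (BqTau.homMk ι hc : BqTau.mk K D hD ⟶ M) ≫ f = 0,
              Nonempty (IsLimit
                (KernelFork.ofι (BqTau.homMk ι hc : BqTau.mk K D hD ⟶ M) h))) ∧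
      (HasCokernel ((BqTau.forget θ τ).map f) ∧
        ∀ (C : Bq.{w} θ) (π : N.toBq ⟶ C) (hπ : (BqTau.forget θ τ).map f ≫ π = 0),
          Nonempty (IsColimit (CokernelCofork.ofπ π hπ)) →
          ∃ (D : Connection τ C) (hD : D.IsRegularSingular) (hc : Compatible N.conn D π),
            (∀ D' : Connection τ C, Compatible N.conn D' π → D' = D) ∧
            ∃ h : f ≫ (BqTau.homMk π hc : N ⟶ BqTau.mk C D hD) = 0,
              Nonempty (IsColimit
                (CokernelCofork.ofπ (BqTau.homMk π hc : N ⟶ BqTau.mk C D hD) h))) := by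
  have hτ0 : τ ≠ 0 := by
    rintro rfl
    simp at hτ
  -- The abelian structure is built over the given preadditive instance, so agreement with pointwise
  -- addition is definitional.
  refine ⟨⟨{ toIsNormalMonoCategory := BqTau.isNormalMonoCategory hτ0
             toIsNormalEpiCategory := BqTau.isNormalEpiCategory hτ0
             has_finite_products := BqTau.hasFiniteProducts hτ0
             has_kernels := BqTau.hasKernels hτ0
             has_cokernels := BqTau.hasCokernels hτ0 }, rfl⟩, fun M N f => ⟨⟨?_, ?_⟩, ?_, ?_⟩⟩
  · exact BqTau.hasKernel_forget_map hτ0 f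
  · exact BqTau.exists_connection_of_isLimit hτ0 f
  · exact BqTau.hasCokernel_forget_map hτ0 f
  · exact BqTau.exists_connection_of_isColimit hτ0 f
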